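/- **Setting.** Let $d\in\{1,2,3\}$, let $\mathcal O\subset\mathbb R^d$ be a bounded convex domain with polygonal boundary (the non-empty interior of the convex hull of finitely many points), $L^p=L^p(\mathcal O;\mathbb R)$, and let $\Lambda$ be the Laplacian on $\mathcal O$ with homogeneous Dirichlet boundary condition, $-\Lambda e_i=\lambda_i e_i$, where $0<\lambda_1\le\lambda_2\le\cdots$ and $(e_i)$ is an orthonormal basis of $L^2$. Put $\|u\|_{\dot{\mathbb H}^r}^2=\sum_i\lambda_i^r\langle u,e_i\rangle_{L^2}^2$, $\dot{\mathbb H}^r=\mathcal D((-\Lambda)^{r/2})$, $\mathbb H^1=\dot{\mathbb H}^1\times L^2$ and $\Theta u=(u,\partial_{x_1}u,\dots,\partial_{x_d}u)$. Let $\mathbf Q$ be a symmetric, positive definite operator on $L^2$ of finite trace, $(\Omega,\mathcal F,\{\mathcal F_t\}_{t\ge0},\mathbb P)$ a filtered probability space and $W(t)=\sum_k \beta_k(t)\,\mathbf Q^{1/2}e_k$ a $\mathbf Q$-Wiener process on it, with independent real $\{\mathcal F_t\}$-Brownian motions $\beta_k$ such that the sequence $(\beta_k(t)-\beta_k(s))_k$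 is independent of $\mathcal F_s$ for $s\le t$. Write $\mathcal L_2^0$ for the Hilbert–Schmidt operators from $\mathbf Q^{1/2}(L^2)$ (with the norm $\|\mathbf Q^{1/2}x\|=\|x\|_{L^2}$) to $L^2$, so that $\|G\|_{\mathcal L_2^0}^2=\sum_i\|G\mathbf Q^{1/2}e_i\|_{L^2}^2$, and $G\,(W(t)-W(s))=\sum_k(\beta_k(t)-\beta_k(s))\,G\mathbf Q^{1/2}e_k$, the series converging in probability in $L^2$. **Assumptions on the coefficients.** Let $k\in\mathbb N^+$ and $\delta_0>0$. Let $\widetilde F:\mathbb R\to\mathbb R$ be differentiable with $\widetilde F'=f$; for $u\in\dot{\mathbb H}^1$ let $f(u)=f\circ u$ and $F(u)=\int_{\mathcal O}\widetilde F(u(x))\,dx$. Assume that for every $u\in\dot{\mathbb H}^1$ we have $f(u)\in L^2$, $\widetilde F\circ u\in L^1$, $u\in L^{2k+2}$ and $g(\Theta u)\in\mathcal L_2^0$, and that there are polynomials $b_1,b_2,b_3$ of degrees at most $2k+1$, $2k$, $k$ and constants $c_2'\ge0$, $c_3,c_4,c>0$ such that for all $u,\widetilde u\in\dot{\mathbb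 H}^1$ $$\|f(u)\|_{L^2}\le b_1(\|u\|_{\dot{\mathbb H}^1}),\qquad \|f(u)-f(\widetilde u)\|_{L^2}\le b_2(\|u\|_{\dot{\mathbb H}^1},\|\widetilde u\|_{\dot{\mathbb H}^1})\|u-\widetilde u\|_{\dot{\mathbb H}^1},$$ $$\|g(\Theta u)\|_{\mathcal L_2^0}\le c_2'\big(1+\|u\|_{L^{2k+2}}^{k+1}+\|u\|_{\dot{\mathbb H}^1}\big),\qquad \|g(\Theta u)-g(\Theta\widetilde u)\|_{\mathcal L_2^0}\le b_3(\|u\|_{\dot{\mathbb H}^1},\|\widetilde u\|_{\dot{\mathbb H}^1})\|u-\widetilde u\|_{\dot{\mathbb H}^1},$$ $$F(u)+\delta_0\ge c_3\|u\|_{L^2}^2+c_4\|u\|_{L^{2k+2}}^{2k+2},\qquad F(u)+\delta_0\ge c.$$ Assume in addition that, for some $c_2>0$, $\|g(\Theta u)\|_{\mathcal L_2^0}\le c_2(1+\|u\|_{\dot{\mathbb H}^1})$ for all $u\in\dot{\mathbb H}^1$. Let $X_0=(u_0,v_0)$ be an $\mathcal F_0$-measurable, $\mathbb H^1$-valued random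 variable with $\mathbb E\|X_0\|_{\mathbb H^1}^r<\infty$ for all $r\in\mathbb N$ (for instance a deterministic $X_0\in\mathbb H^1$). **Schemes.** Let $T>0$, $N\in\mathbb N^+$, $\tau=T/N$, $t_n=n\tau$, $\delta W_n=W(t_{n+1})-W(t_n)$ and $q_0=\sqrt{F(u_0)+\delta_0}$. Let $\widehat u_n$ be either $u_n$ for all $n$, or $\frac{3u_n-u_{n-1}}2$ for all $n$, where $u_{-1}=u_0$. For $0\le n<N$ both schemes use $$q_{n+1}=q_n+\frac{\langle f(\widehat u_n),u_{n+1}-u_n\rangle_{L^2}}{2\sqrt{F(\widehat u_n)+\delta_0}},$$ together with, in the midpoint SAV scheme, $$u_{n+1}=u_n+\tfrac\tau2(v_n+v_{n+1})+\tfrac\tau2\,g(\Theta u_n)\delta W_n,$$ $$v_{n+1}=v_n+\tfrac\tau2\Lambda(u_n+u_{n+1})-\tau\frac{f(\widehat u_n)}{\sqrt{F(\widehat u_n)+\delta_0}}\,\frac{q_n+q_{n+1}}2+g(\Theta u_n)\delta W_n,$$ and, in the exponential SAV scheme, with $X_n=(u_n,v_n)^\top$, $$X_{n+1}=E(\tau)X_n+A^{-1}(E(\tau)-I)\Big(0,-\frac{f(\widehat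 u_n)}{\sqrt{F(\widehat u_n)+\delta_0}}\,\frac{q_n+q_{n+1}}2\Big)^{\!\top}+E(\tau)\big(0,g(\Theta u_n)\delta W_n\big)^\top,$$ where $A=\begin{bmatrix}0&I\\ \Lambda&0\end{bmatrix}$ and $$E(t)=e^{tA}=\begin{bmatrix}\cos(t(-\Lambda)^{1/2})&(-\Lambda)^{-1/2}\sin(t(-\Lambda)^{1/2})\\-(-\Lambda)^{1/2}\sin(t(-\Lambda)^{1/2})&\cos(t(-\Lambda)^{1/2})\end{bmatrix}.$$ A numerical solution is an $\{\mathcal F_{t_n}\}$-adapted process $(u_n,v_n,q_n)_{0\le n\le N}$ in $\dot{\mathbb H}^1\times L^2\times\mathbb R$, starting at $(u_0,v_0,q_0)$, that satisfies these equations almost surely. Let $V(u,v,q)=\frac12\|u\|_{\dot{\mathbb H}^1}^2+\frac12\|v\|_{L^2}^2+q^2$. **Claim.** For every real $p\ge1$ there is a constant $C>0$, depending on $p$, $X_0$, $\mathbf Q$, $T$ (and on the fixed data $\mathcal O,f,g,\delta_0$ and the constants above) but not on $N$ and $\tau$, such that for every $N$ the numerical solution of the midpoint scheme and that of the exponential scheme,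 with either choice of $\widehat u_n$, satisfy $$\sup_{0\le n\le N}\mathbb E\big[V^p(u_n,v_n,q_n)\big]\le C.$$ -/

import Mathlib

open MeasureTheory ProbabilityTheory Filter Topology
open scoped NNReal ENNReal RealInnerProductSpace

noncomputable section

namespace SAV

/-! ### The spatial domain and weak derivatives -/

/-- A (non-empty) bounded convex domain of `ℝ^d` with polygonal boundary, that is, the interior of
the convex hull of finitely many points (an interval, a convex polygon, a convex polyhedron). -/
def IsConvexPolygonalDomain {d : ℕ} (O : Set (EuclideanSpace ℝ (Fin d))) : Prop :=
  O.Nonempty ∧ ∃ s : Finset (EuclideanSpace ℝ (Fin d)),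
    O = interior (convexHull ℝ (s : Set (EuclideanSpace ℝ (Fin d))))

/-- The real Hilbert space `L²(O)`. -/
abbrev L2 {d : ℕ} (O : Set (EuclideanSpace ℝ (Fin d))) : Type :=
  Lp ℝ 2 (volume.restrict O)

/-- `φ ∈ C_c^∞(O)`. -/
structure IsTestFunction {d : ℕ} (O : Set (EuclideanSpace ℝ (Fin d)))
    (φ : EuclideanSpace ℝ (Fin d) → ℝ) : Prop where
  smooth : ContDiff ℝ ((⊤ : ℕ∞) : WithTop ℕ∞) φ
  compact : HasCompactSupport φ
  support : tsupport φ ⊆ O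

/-- The classical partial derivative `∂_j φ`. -/
def partialDeriv {d : ℕ} (j : Fin d) (φ : EuclideanSpace ℝ (Fin d) → ℝ)
    (x : EuclideanSpace ℝ (Fin d)) : ℝ :=
  fderiv ℝ φ x (EuclideanSpace.single j 1)

/-- `w ∈ L²(O)` is the weak partial derivative `∂_j u` of `u ∈ L²(O)`. -/
def IsWeakPartial {d : ℕ} {O : Set (EuclideanSpace ℝ (Fin d))} (j : Fin d) (u w : L2 O) : Prop :=
  ∀ φ : EuclideanSpace ℝ (Fin d) → ℝ, IsTestFunction O φ →
    ∫ x in O, u x * partialDeriv j φ x = - ∫ x in O, w x * φ x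

open Classical in
/-- The weak derivative `∂_j u`, for `u` that possesses one in `L²(O)` (and `0` otherwise). -/
def weakPartial {d : ℕ} {O : Set (EuclideanSpace ℝ (Fin d))} (j : Fin d) (u : L2 O) : L2 O :=
  if h : ∃ w : L2 O, IsWeakPartial j u w then h.choose else 0

/-- `u ∈ H¹₀(O)`: `u` is the limit in `H¹(O)` of functions in `C_c^∞(O)`. -/
def MemH10 {d : ℕ} {O : Set (EuclideanSpace ℝ (Fin d))} (u : L2 O) : Prop :=
  ∃ (φ : ℕ → EuclideanSpace ℝ (Fin d) → ℝ) (w : Fin d → L2 O),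
    (∀ m, IsTestFunction O (φ m)) ∧
    Tendsto (fun m => eLpNorm (fun x => φ m x - u x) 2 (volume.restrict O)) atTop (𝓝 0) ∧
    ∀ j, Tendsto (fun m => eLpNorm (fun x => partialDeriv j (φ m) x - w j x) 2
      (volume.restrict O)) atTop (𝓝 0)

/-! ### The Dirichlet Laplacian, its eigenpairs and its functional calculus -/

/-- The eigenpairs `(λ_i, e_i)` of `-Λ`, where `Λ` is the Laplacian with homogeneous Dirichlet
boundary condition: `(e_i)` is an orthonormal basis of `L²(O)`, each `e_i` lies in `H¹₀(O)` and is
a weak solution of `-Δ e_i = λ_i e_i`, and `0 < λ_0 ≤ λ_1 ≤ ⋯`. -/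
structure DirichletEigenpairs {d : ℕ} (O : Set (EuclideanSpace ℝ (Fin d))) where
  /-- the eigenvalues -/
  eig : ℕ → ℝ
  /-- the eigenfunctions -/
  e : HilbertBasis ℕ ℝ (L2 O)
  eig_pos : ∀ i, 0 < eig i
  eig_mono : Monotone eig
  memH10 : ∀ i, MemH10 (e i)
  eigen : ∀ i, ∀ φ : EuclideanSpace ℝ (Fin d) → ℝ, IsTestFunction O φ →
    ∑ j, ∫ x in O, weakPartial j (e i) x * partialDeriv j φ x = eig i * ∫ x in O, e i x * φ x

namespace DirichletEigenpairs

variable {d : ℕ} {O : Set (EuclideanSpace ℝ (Fin d))} (S : DirichletEigenpairs O)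

/-- `u ∈ Ḣ¹ = D((-Λ)^{1/2})`. -/
def MemH1 (u : L2 O) : Prop :=
  Summable fun i => S.eig i * ⟪S.e i, u⟫ ^ 2

/-- The norm of `Ḣ¹`: `‖u‖² = ∑ λ_i ⟨u, e_i⟩²`. -/
def normH1 (u : L2 O) : ℝ :=
  √(∑' i, S.eig i * ⟪S.e i, u⟫ ^ 2)

/-- The norm of `(u, v)` in the product space `Ḣ¹ × L²`. -/
def normProd (u v : L2 O) : ℝ :=
  √(S.normH1 u ^ 2 + ‖v‖ ^ 2)

/-- The operator `m(-Λ)`, `m(-Λ) x = ∑ m(λ_i) ⟨e_i, x⟩ e_i`, for `x` in its domain. -/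
def spec (m : ℝ → ℝ) (x : L2 O) : L2 O :=
  ∑' i, (m (S.eig i) * ⟪S.e i, x⟫) • S.e i

/-- The group `E(t) = exp(tA)`, `A = [0, I; Λ, 0]`, given by the matrix
`[cos(t(-Λ)^{1/2}), (-Λ)^{-1/2} sin(t(-Λ)^{1/2}); -(-Λ)^{1/2} sin(t(-Λ)^{1/2}), cos(t(-Λ)^{1/2})]`
(on `Ḣ¹ × L²`). -/
def waveGroup (t : ℝ) (X : L2 O × L2 O) : L2 O × L2 O :=
  (S.spec (fun s => Real.cos (t * √s)) X.1 + S.spec (fun s => (√s)⁻¹ * Real.sin (t * √s)) X.2,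
    - S.spec (fun s => √s * Real.sin (t * √s)) X.1 + S.spec (fun s => Real.cos (t * √s)) X.2)

/-- `A⁻¹ = [0, Λ⁻¹; I, 0]`, on `L² × L²`. -/
def invA (X : L2 O × L2 O) : L2 O × L2 O :=
  (- S.spec (fun s => s⁻¹) X.2, X.1)

end DirichletEigenpairs

/-- `Θ u = (u, ∂_1 u, …, ∂_d u)`. -/
def Theta {d : ℕ} {O : Set (EuclideanSpace ℝ (Fin d))} (u : L2 O) : L2 O × (Fin d → L2 O) :=
  (u, fun j => weakPartial j u)

/-! ### Noise operators and the driving noise -/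

/-- Linear maps from `Q^{1/2}(L²)` to `L²`; the first argument `R` is `Q^{1/2}`. -/
abbrev NoiseOp {d : ℕ} {O : Set (EuclideanSpace ℝ (Fin d))} (R : L2 O →L[ℝ] L2 O) : Type :=
  LinearMap.range R.toLinearMap →ₗ[ℝ] L2 O

namespace NoiseOp

variable {d : ℕ} {O : Set (EuclideanSpace ℝ (Fin d))} {R : L2 O →L[ℝ] L2 O}

/-- The value `G Q^{1/2} x`. -/
def at_ (G : NoiseOp R) (x : L2 O) : L2 O :=
  G ⟨R x, LinearMap.mem_range_self R.toLinearMap x⟩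

/-- `G` is a Hilbert--Schmidt operator from `Q^{1/2}(L²)` to `L²`. Here `Q^{1/2}` is injective and
`Q^{1/2}(L²)` carries the norm `‖Q^{1/2} x‖ = ‖x‖_{L²}`, so `(Q^{1/2} e_i)` is one of its
orthonormal bases. -/
def IsHS (S : DirichletEigenpairs O) (G : NoiseOp R) : Prop :=
  (∃ K : ℝ, ∀ x, ‖G.at_ x‖ ≤ K * ‖x‖) ∧ Summable fun i => ‖G.at_ (S.e i)‖ ^ 2

/-- The Hilbert--Schmidt norm of `G : Q^{1/2}(L²) → L²`. -/
def hsNorm (S : DirichletEigenpairs O) (G : NoiseOp R) : ℝ :=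
  √(∑' i, ‖G.at_ (S.e i)‖ ^ 2)

end NoiseOp

/-- `β_1, β_2, …` are independent real Brownian motions with respect to the filtration `ℱ`: they are
adapted, and the increments of the whole sequence after time `s` are independent of `ℱ_s`. The
`Q`-Wiener process is `W(t) = ∑_k β_k(t) Q^{1/2} e_k`. -/
structure IsBrownianSequence {Ω : Type*} [m : MeasurableSpace Ω] (P : Measure Ω)
    (ℱ : Filtration ℝ≥0 m) (β : ℕ → ℝ≥0 → Ω → ℝ) : Prop where
  brownian : ∀ k, IsBrownianReal (β k) P
  adapted : ∀ k, Adapted ℱ (β k)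
  indep : iIndepFun (fun k ω (t : ℝ≥0) => β k t ω) P
  indep_past : ∀ s t : ℝ≥0, s ≤ t →
    Indep (MeasurableSpace.comap (fun ω k => β k t ω - β k s ω) inferInstance) (ℱ s) P

/-- `Y = G (W(t) - W(s))`, for a random operator `G`: the series
`∑_k (β_k(t) - β_k(s)) G Q^{1/2} e_k` converges to `Y` in `L²(O)`, in probability. -/
def IsNoiseIncrement {d : ℕ} {O : Set (EuclideanSpace ℝ (Fin d))} (S : DirichletEigenpairs O)
    {R : L2 O →L[ℝ] L2 O} {Ω : Type*} [MeasurableSpace Ω] (P : Measure Ω)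
    (β : ℕ → ℝ≥0 → Ω → ℝ) (s t : ℝ≥0) (G : Ω → NoiseOp R) (Y : Ω → L2 O) : Prop :=
  TendstoInMeasure P
    (fun (m : ℕ) ω => ∑ k ∈ Finset.range m, (β k t ω - β k s ω) • (G ω).at_ (S.e k)) atTop Y

/-! ### The coefficients -/

open Classical in
/-- The Nemytskii operator `u ↦ f ∘ u`, for `u` with `f ∘ u ∈ L²(O)` (and `0` otherwise). -/
def nemytskii {d : ℕ} {O : Set (EuclideanSpace ℝ (Fin d))} (f : ℝ → ℝ) (u : L2 O) : L2 O :=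
  if h : MemLp (fun x => f (u x)) 2 (volume.restrict O) then h.toLp else 0

/-- The potential `F(u) = ∫_O F̃(u(x)) dx`. -/
def potential {d : ℕ} {O : Set (EuclideanSpace ℝ (Fin d))} (Ft : ℝ → ℝ) (u : L2 O) : ℝ :=
  ∫ x in O, Ft (u x)

/-- The norm of `u` in `L^{2k+2}(O)`. -/
def normL {d : ℕ} {O : Set (EuclideanSpace ℝ (Fin d))} (k : ℕ) (u : L2 O) : ℝ :=
  lpNorm u ((2 * k + 2 : ℕ) : ℝ≥0∞) (volume.restrict O)

/-- `Q` is symmetric and positive definite, `R = Q^{1/2}` is its positive square root, and `R` is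
Hilbert--Schmidt (that is, `Q` has finite trace). -/
structure IsCovariance {d : ℕ} {O : Set (EuclideanSpace ℝ (Fin d))} (S : DirichletEigenpairs O)
    (Q R : L2 O →L[ℝ] L2 O) : Prop where
  symm : ∀ x y, ⟪Q x, y⟫ = ⟪x, Q y⟫
  pos : ∀ x, x ≠ 0 → 0 < ⟪Q x, x⟫
  sqrt_pos : R.IsPositive
  sqrt_sq : R ∘L R = Q
  sqrt_hs : Summable fun i => ‖R (S.e i)‖ ^ 2

/-- The standing assumptions on the coefficients. The values of `g` matter only at `Θ u`,
`u ∈ Ḣ¹`. -/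
structure CoefficientAssumption {d : ℕ} {O : Set (EuclideanSpace ℝ (Fin d))}
    (S : DirichletEigenpairs O) {R : L2 O →L[ℝ] L2 O} (k : ℕ) (δ₀ : ℝ) (f Ft : ℝ → ℝ)
    (g : L2 O × (Fin d → L2 O) → NoiseOp R) : Prop where
  k_pos : 1 ≤ k
  δ₀_pos : 0 < δ₀
  /-- `f = F̃'` -/
  deriv : ∀ x, HasDerivAt Ft (f x) x
  /-- the Nemytskii operator `f` maps `Ḣ¹` to `L²` -/
  f_memLp : ∀ u, S.MemH1 u → MemLp (fun x => f (u x)) 2 (volume.restrict O)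
  /-- the potential is well defined on `Ḣ¹` -/
  F_integrable : ∀ u, S.MemH1 u → Integrable (fun x => Ft (u x)) (volume.restrict O)
  f_growth : ∃ b₁ : Polynomial ℝ, b₁.natDegree ≤ 2 * k + 1 ∧
    ∀ u, S.MemH1 u → ‖nemytskii f u‖ ≤ b₁.eval (S.normH1 u)
  f_lipschitz : ∃ b₂ : MvPolynomial (Fin 2) ℝ, b₂.totalDegree ≤ 2 * k ∧
    ∀ u u', S.MemH1 u → S.MemH1 u' → ‖nemytskii f u - nemytskii f u'‖ ≤
      MvPolynomial.eval ![S.normH1 u, S.normH1 u'] b₂ * S.normH1 (u - u')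
  g_hs : ∀ u, S.MemH1 u → (g (Theta u)).IsHS S
  /-- the elements of `Ḣ¹` lie in `L^{2k+2}`, so that the norms below make sense -/
  memLp : ∀ u, S.MemH1 u → MemLp u ((2 * k + 2 : ℕ) : ℝ≥0∞) (volume.restrict O)
  g_growth : ∃ c₂ : ℝ, 0 ≤ c₂ ∧
    ∀ u, S.MemH1 u → (g (Theta u)).hsNorm S ≤ c₂ * (1 + normL k u ^ (k + 1) + S.normH1 u)
  g_lipschitz : ∃ b₃ : MvPolynomial (Fin 2) ℝ, b₃.totalDegree ≤ k ∧
    ∀ u u', S.MemH1 u → S.MemH1 u' → NoiseOp.hsNorm S (g (Theta u) - g (Theta u')) ≤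
      MvPolynomial.eval ![S.normH1 u, S.normH1 u'] b₃ * S.normH1 (u - u')
  coercive : ∃ c₃ c₄ : ℝ, 0 < c₃ ∧ 0 < c₄ ∧
    ∀ u, S.MemH1 u → c₃ * ‖u‖ ^ 2 + c₄ * normL k u ^ (2 * k + 2) ≤ potential Ft u + δ₀
  /-- `q = √(F(u) + δ₀)` is bounded away from zero -/
  lower : ∃ c : ℝ, 0 < c ∧ ∀ u, S.MemH1 u → c ≤ potential Ft u + δ₀

/-! ### The numerical schemes -/

/-- The two choices of the explicit approximation `û_n`. -/
inductive Predictor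
  /-- `û_n = u_n` -/
  | current
  /-- `û_n = (3 u_n - u_{n-1}) / 2`, with `u_{-1} = u_0` -/
  | extrapolated

/-- The approximation `û_n`; for `n = 0` the truncated index `n - 1 = 0` encodes
`u_{-1} = u_0`. -/
def Predictor.hat {H : Type*} [AddCommGroup H] [Module ℝ H] (π : Predictor) (u : ℕ → H) (n : ℕ) :
    H :=
  match π with
  | .current => u n
  | .extrapolated => (2⁻¹ : ℝ) • ((3 : ℝ) • u n - u (n - 1))

section Steps

variable {d : ℕ} {O : Set (EuclideanSpace ℝ (Fin d))} (S : DirichletEigenpairs O)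
  (δ₀ : ℝ) (f Ft : ℝ → ℝ)

/-- The vector `f(û) / √(F(û) + δ₀)`. -/
def normalizedForce (w : L2 O) : L2 O :=
  (√(potential Ft w + δ₀))⁻¹ • nemytskii f w

/-- The update of the scalar auxiliary variable:
`q' = q + ⟨f(û), u' - u⟩ / (2 √(F(û) + δ₀))`. -/
def AuxStep (w u u' : L2 O) (q q' : ℝ) : Prop :=
  q' = q + ⟪nemytskii f w, u' - u⟫ / (2 * √(potential Ft w + δ₀))

/-- One step of the midpoint SAV scheme from `(u, v, q)` to `(u', v', q')`, where `w` is `û` and `y`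
is the noise term `g(Θu)δW`. The second equation, which contains `Λ(u + u')`, is an identity in
`Ḣ⁻¹` and is read in each of its coordinates, with `⟨Λ z, e_i⟩ = - λ_i ⟨z, e_i⟩`. -/
structure MidpointStep (τ : ℝ) (w y u v : L2 O) (q : ℝ) (u' v' : L2 O) (q' : ℝ) : Prop where
  first : u' = u + (τ / 2) • (v + v') + (τ / 2) • y
  second : ∀ i, ⟪S.e i, v'⟫ = ⟪S.e i, v⟫ + τ / 2 * (- S.eig i * ⟪S.e i, u + u'⟫)
    - τ * ⟪S.e i, normalizedForce δ₀ f Ft w⟫ * ((q + q') / 2) + ⟪S.e i, y⟫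
  third : AuxStep δ₀ f Ft w u u' q q'

/-- One step of the exponential SAV scheme,
`X' = E(τ) X + A⁻¹ (E(τ) - I) (0, -f(û)/√(F(û)+δ₀) (q + q')/2) + E(τ) (0, g(Θu)δW)`. -/
structure ExponentialStep (τ : ℝ) (w y u v : L2 O) (q : ℝ) (u' v' : L2 O) (q' : ℝ) : Prop where
  first : (u', v') = S.waveGroup τ (u, v)
    + S.invA (S.waveGroup τ (0, -(((q + q') / 2) • normalizedForce δ₀ f Ft w))
        - (0, -(((q + q') / 2) • normalizedForce δ₀ f Ft w)))
    + S.waveGroup τ (0, y)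
  second : AuxStep δ₀ f Ft w u u' q q'

/-- The modified energy `V(u, v, q) = ½ ‖u‖²_{Ḣ¹} + ½ ‖v‖²_{L²} + q²`. -/
def energy (u v : L2 O) (q : ℝ) : ℝ :=
  1 / 2 * S.normH1 u ^ 2 + 1 / 2 * ‖v‖ ^ 2 + q ^ 2

end Steps

/-- The two schemes. -/
inductive Scheme
  | midpoint
  | exponential

/-- `(u_n, v_n, q_n)_{0 ≤ n ≤ N}` is the numerical solution of the chosen scheme with step size
`τ`: an adapted `Ḣ¹ × L² × ℝ`-valued process that starts at `(u₀, v₀, √(F(u₀) + δ₀))` and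
satisfies the equations of the scheme almost surely. -/
structure IsNumericalSolution {d : ℕ} {O : Set (EuclideanSpace ℝ (Fin d))}
    (S : DirichletEigenpairs O) {R : L2 O →L[ℝ] L2 O} (δ₀ : ℝ) (f Ft : ℝ → ℝ)
    (g : L2 O × (Fin d → L2 O) → NoiseOp R)
    {Ω : Type*} [m : MeasurableSpace Ω] (P : Measure Ω) (ℱ : Filtration ℝ≥0 m)
    (β : ℕ → ℝ≥0 → Ω → ℝ) (u₀ v₀ : Ω → L2 O) (scheme : Scheme) (π : Predictor)
    (τ : ℝ≥0) (N : ℕ) (u v : ℕ → Ω → L2 O) (q : ℕ → Ω → ℝ) : Prop where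
  u_adapted : ∀ n ≤ N, StronglyMeasurable[ℱ (n * τ)] (u n)
  v_adapted : ∀ n ≤ N, StronglyMeasurable[ℱ (n * τ)] (v n)
  q_adapted : ∀ n ≤ N, StronglyMeasurable[ℱ (n * τ)] (q n)
  memH1 : ∀ n ≤ N, ∀ᵐ ω ∂P, S.MemH1 (u n ω)
  init_u : u 0 =ᵐ[P] u₀
  init_v : v 0 =ᵐ[P] v₀
  init_q : ∀ᵐ ω ∂P, q 0 ω = √(potential Ft (u₀ ω) + δ₀)
  step : ∀ n < N, ∃ Y : Ω → L2 O,
    IsNoiseIncrement S P β (n * τ) ((n + 1) * τ) (fun ω => g (Theta (u n ω))) Y ∧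
    ∀ᵐ ω ∂P,
      match scheme with
      | .midpoint => MidpointStep S δ₀ f Ft τ (π.hat (fun j => u j ω) n) (Y ω)
          (u n ω) (v n ω) (q n ω) (u (n + 1) ω) (v (n + 1) ω) (q (n + 1) ω)
      | .exponential => ExponentialStep S δ₀ f Ft τ (π.hat (fun j => u j ω) n) (Y ω)
          (u n ω) (v n ω) (q n ω) (u (n + 1) ω) (v (n + 1) ω) (q (n + 1) ω)

end SAV

end

/-! Both schemes conserve the modified energy up to noise: `V` after a step equals `V` at `(u_n, v_n
+ Y, q_n)`, where `Y` is the noise increment (`MidpointStep.energy_eq`,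
`ExponentialStep.energy_eq`). In each eigenmode the step is linear with a frozen force, and by the
update of `q` the work of that force sums to `2 (q'² - q²)`. Thus `f` and the predictor drop out,
and only the effect of replacing `v_n` by `v_n + Y` has to be estimated.

Here `Y = ∑ ξ_k G_k`, with `G_k` known at time `t_n` and `ξ_k` independent centred Gaussians of
variance `τ`. Linear growth of `g` gives `∑ ‖G_k‖² ≤ K a`, where `a = 1 + ½ ‖u_n‖² + q_n²` is the
part of `1 + V` that the noise leaves alone. The modes are added one at a time. Adding mode `k`
multiplies the conditional mean of the `(r+1)`-st power by at most `1 + c α_k`, with `α_k = ‖G_k‖² /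
a` and `c` of order `τ`: the linear term averages to zero and the remainder carries the factor `α_k`
(`pow_perturbation_le`, `exists_integral_momentWeight_le`). The weight `exp(-c ∑ α_k)` absorbs these
factors, and `∑ α_k ≤ K` bounds it below independently of the number of modes
(`integrable_and_integral_damping_le`). Fatou's lemma then reaches `Y`.

So each step multiplies the moments of `1 + V` by at most `exp(C τ)`, which iterates to `exp(C T)`.
The initial moment is finite because `F` grows polynomially in the norm of `Ḣ¹`
(`exists_potential_le`). -/

namespace SAV

/-! ### Exact energy identities for the two schemes, mode by mode -/

section Energy

variable {d : ℕ} {O : Set (EuclideanSpace ℝ (Fin d))} (S : DirichletEigenpairs O)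

namespace DirichletEigenpairs

lemma hasSum_coord_mul (x y : L2 O) : HasSum (fun i => ⟪S.e i, x⟫ * ⟪S.e i, y⟫) ⟪x, y⟫ := by
  have := S.e.hasSum_inner_mul_inner x y
  simpa only [real_inner_comm] using this

lemma hasSum_coord_sq (x : L2 O) : HasSum (fun i => ⟪S.e i, x⟫ ^ 2) (‖x‖ ^ 2) := by
  have := S.hasSum_coord_mul x x
  rw [real_inner_self_eq_norm_sq] at this
  simpa only [sq] using this

lemma sq_normH1 (u : L2 O) : S.normH1 u ^ 2 = ∑' i, S.eig i * ⟪S.e i, u⟫ ^ 2 :=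
  Real.sq_sqrt (tsum_nonneg fun i => mul_nonneg (S.eig_pos i).le (sq_nonneg _))

lemma normH1_nonneg (u : L2 O) : 0 ≤ S.normH1 u := Real.sqrt_nonneg _

variable {S} in
lemma MemH1.hasSum {u : L2 O} (hu : S.MemH1 u) :
    HasSum (fun i => S.eig i * ⟪S.e i, u⟫ ^ 2) (S.normH1 u ^ 2) := by
  rw [sq_normH1]
  exact Summable.hasSum hu

lemma summable_coord_sq (x : L2 O) : Summable fun i => ⟪S.e i, x⟫ ^ 2 :=
  (S.hasSum_coord_sq x).summable

/-- Square-summability makes the series in `spec` converge; otherwise the `tsum` would be a default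
value. -/
lemma spec_coord (m : ℝ → ℝ) (x : L2 O)
    (h : Summable fun i => (m (S.eig i) * ⟪S.e i, x⟫) ^ 2) (i : ℕ) :
    ⟪S.e i, S.spec m x⟫ = m (S.eig i) * ⟪S.e i, x⟫ := by
  have hmem : Memℓp (fun i => m (S.eig i) * ⟪S.e i, x⟫) 2 := by
    refine memℓp_gen ?_
    simpa [mul_pow] using h
  let a : lp (fun _ : ℕ => ℝ) 2 := ⟨fun i => m (S.eig i) * ⟪S.e i, x⟫, hmem⟩
  have hs : HasSum (fun i => a i • S.e i) (S.e.repr.symm a) := S.e.hasSum_repr_symm a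
  have : S.spec m x = S.e.repr.symm a := hs.tsum_eq
  rw [this, ← S.e.repr_apply_apply, LinearIsometryEquiv.apply_symm_apply]

lemma spec_coord_of_bounded (m : ℝ → ℝ) (x : L2 O) (B : ℝ) (hB : ∀ i, |m (S.eig i)| ≤ B) (i : ℕ) :
    ⟪S.e i, S.spec m x⟫ = m (S.eig i) * ⟪S.e i, x⟫ := by
  refine S.spec_coord m x (Summable.of_nonneg_of_le (fun _ => sq_nonneg _) (fun i => ?_)
    ((S.summable_coord_sq x).mul_left (B ^ 2))) i
  rw [mul_pow]
  exact mul_le_mul_of_nonneg_right (sq_le_sq' (by linarith [abs_le.1 (hB i)])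
    (abs_le.1 (hB i)).2) (sq_nonneg _)

lemma spec_zero (m : ℝ → ℝ) : S.spec m 0 = 0 := by
  simp [spec]

lemma coord_cos (t : ℝ) (x : L2 O) (i : ℕ) :
    ⟪S.e i, S.spec (fun s => Real.cos (t * √s)) x⟫ =
      Real.cos (t * √(S.eig i)) * ⟪S.e i, x⟫ :=
  S.spec_coord_of_bounded (fun s => Real.cos (t * √s)) x 1 (fun _ => Real.abs_cos_le_one _) i

lemma coord_sin_div (t : ℝ) (x : L2 O) (i : ℕ) :
    ⟪S.e i, S.spec (fun s => (√s)⁻¹ * Real.sin (t * √s)) x⟫ =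
      (√(S.eig i))⁻¹ * Real.sin (t * √(S.eig i)) * ⟪S.e i, x⟫ := by
  refine S.spec_coord_of_bounded (fun s => (√s)⁻¹ * Real.sin (t * √s)) x ((√(S.eig 0))⁻¹)
    (fun i => ?_) i
  rw [abs_mul, abs_of_nonneg (inv_nonneg.2 (Real.sqrt_nonneg _))]
  have h1 : (√(S.eig i))⁻¹ ≤ (√(S.eig 0))⁻¹ :=
    inv_anti₀ (Real.sqrt_pos.2 (S.eig_pos 0)) (Real.sqrt_le_sqrt (S.eig_mono (Nat.zero_le i)))
  have h2 := Real.abs_sin_le_one (t * √(S.eig i))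
  calc _ ≤ (√(S.eig i))⁻¹ * 1 := by gcongr
    _ ≤ _ := by simpa using h1

lemma coord_inv (x : L2 O) (i : ℕ) :
    ⟪S.e i, S.spec (fun s => s⁻¹) x⟫ = (S.eig i)⁻¹ * ⟪S.e i, x⟫ := by
  refine S.spec_coord_of_bounded (fun s => s⁻¹) x ((S.eig 0)⁻¹) (fun i => ?_) i
  rw [abs_of_nonneg (inv_nonneg.2 (S.eig_pos i).le)]
  exact inv_anti₀ (S.eig_pos 0) (S.eig_mono (Nat.zero_le i))

/-- The only unbounded multiplier in `waveGroup`, hence the only one that needs `x ∈ Ḣ¹`. -/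
lemma coord_sqrt_sin (t : ℝ) {x : L2 O} (hx : S.MemH1 x) (i : ℕ) :
    ⟪S.e i, S.spec (fun s => √s * Real.sin (t * √s)) x⟫ =
      √(S.eig i) * Real.sin (t * √(S.eig i)) * ⟪S.e i, x⟫ := by
  refine S.spec_coord (fun s => √s * Real.sin (t * √s)) x
    (Summable.of_nonneg_of_le (fun _ => sq_nonneg _) (fun i => ?_) hx) i
  rw [mul_pow, mul_pow, Real.sq_sqrt (S.eig_pos i).le]
  have h2 := Real.sin_sq_le_one (t * √(S.eig i))
  have := S.eig_pos i
  calc _ ≤ S.eig i * 1 * ⟪S.e i, x⟫ ^ 2 := by gcongr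
    _ = _ := by ring

end DirichletEigenpairs

/-- If a step changes the energy of each mode by the work of the force, then the modified energy
after the step is the modified energy of the state with the perturbed velocity. -/
lemma energy_eq_of_coord {u u' v' x F : L2 O} {q q' : ℝ} (hu : S.MemH1 u) (hu' : S.MemH1 u')
    (hF : ⟪F, u' - u⟫ = 2 * (q' - q))
    (h : ∀ i, S.eig i * ⟪S.e i, u'⟫ ^ 2 + ⟪S.e i, v'⟫ ^ 2 =
      S.eig i * ⟪S.e i, u⟫ ^ 2 + ⟪S.e i, x⟫ ^ 2
        - (q + q') * (⟪S.e i, F⟫ * ⟪S.e i, u' - u⟫)) :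
    energy S u' v' q' = energy S u x q := by
  have h1 := hu'.hasSum.add (S.hasSum_coord_sq v')
  have h2 := (hu.hasSum.add (S.hasSum_coord_sq x)).sub
    ((S.hasSum_coord_mul F (u' - u)).mul_left (q + q'))
  have := h1.unique (by simpa only [h] using h2)
  -- The summed work is `(q + q') · 2 (q' - q) = 2 (q'² - q²)`, which is why the schemes use the
  -- average of `q` and `q'`.
  rw [hF] at this
  simp only [energy]
  linear_combination this / 2

variable {S} {δ₀ : ℝ} {f Ft : ℝ → ℝ} {τ : ℝ} {w y u v u' v' : L2 O} {q q' : ℝ}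

lemma AuxStep.inner_normalizedForce (h : AuxStep δ₀ f Ft w u u' q q') :
    ⟪normalizedForce δ₀ f Ft w, u' - u⟫ = 2 * (q' - q) := by
  rw [AuxStep] at h
  rw [h, normalizedForce, real_inner_smul_left, mul_comm 2 (√ _), ← div_div, div_eq_inv_mul _ (√ _)]
  ring

/-- The term `(τ/2) y` in the first equation makes `u' - u` equal to `τ/2` times `v' + (v + y)`.
Testing the second equation with this sum yields a difference of squares on each side. -/
lemma MidpointStep.energy_eq (hτ : 0 < τ) (hu : S.MemH1 u) (hu' : S.MemH1 u')
    (h : MidpointStep S δ₀ f Ft τ w y u v q u' v' q') :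
    energy S u' v' q' = energy S u (v + y) q := by
  refine energy_eq_of_coord S hu hu' h.third.inner_normalizedForce fun i => ?_
  have h1 : ⟪S.e i, u'⟫ = ⟪S.e i, u⟫ + τ / 2 * (⟪S.e i, v⟫ + ⟪S.e i, v'⟫)
      + τ / 2 * ⟪S.e i, y⟫ := by
    rw [h.first]
    simp only [inner_add_right, real_inner_smul_right]
  have h2 := h.second i
  rw [inner_add_right] at h2
  rw [inner_sub_right, inner_add_right]
  refine mul_left_cancel₀ hτ.ne' ?_
  linear_combination (τ * ⟪S.e i, v'⟫ + τ * (⟪S.e i, v⟫ + ⟪S.e i, y⟫)) * h2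
    + (-τ * S.eig i * (⟪S.e i, u⟫ + ⟪S.e i, u'⟫) * (-1)
        + τ * ⟪S.e i, normalizedForce δ₀ f Ft w⟫ * (q + q')) * h1

/-- Each mode solves an oscillator under the constant force `-B`, exactly, from the velocity `v +
y`. About the shifted equilibrium `-B / l²` the flow is a rotation of `(l u + B / l, v)`, so the sum
of squares is preserved. -/
lemma ExponentialStep.energy_eq (hu : S.MemH1 u) (hu' : S.MemH1 u')
    (h : ExponentialStep S δ₀ f Ft τ w y u v q u' v' q') :
    energy S u' v' q' = energy S u (v + y) q := by
  refine energy_eq_of_coord S hu hu' h.second.inner_normalizedForce fun i => ?_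
  have h1 := congrArg (fun X => ⟪S.e i, X.1⟫) h.first
  have h2 := congrArg (fun X => ⟪S.e i, X.2⟫) h.first
  simp only [DirichletEigenpairs.waveGroup, DirichletEigenpairs.invA, S.spec_zero, Prod.fst_add,
    Prod.snd_add, Prod.snd_sub, Prod.fst_sub, inner_add_right, inner_neg_right, inner_sub_right,
    zero_add, neg_zero, sub_zero, S.coord_cos, S.coord_sin_div, S.coord_inv,
    S.coord_sqrt_sin τ hu, real_inner_smul_right] at h1 h2
  rw [inner_sub_right, inner_add_right]
  have hl := Real.sq_sqrt (S.eig_pos i).le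
  have hlp := Real.sqrt_pos.2 (S.eig_pos i)
  have hcs := Real.sin_sq_add_cos_sq (τ * √(S.eig i))
  generalize Real.sin (τ * √(S.eig i)) = s at *
  generalize Real.cos (τ * √(S.eig i)) = c at *
  generalize √(S.eig i) = l at *
  rw [← hl] at h1 ⊢
  generalize ⟪S.e i, u'⟫ = U at *
  generalize ⟪S.e i, v'⟫ = V at *
  generalize ⟪S.e i, u⟫ = U₀ at *
  generalize ⟪S.e i, v⟫ = V₀ at *
  generalize ⟪S.e i, y⟫ = Y at *
  generalize hB : (q + q') / 2 * ⟪S.e i, normalizedForce δ₀ f Ft w⟫ = B at *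
  have hB' : (q + q') * (⟪S.e i, normalizedForce δ₀ f Ft w⟫ * (U - U₀)) =
      2 * B * (U - U₀) := by
    rw [← hB]; ring
  rw [hB']
  have e1 : l * U = -B / l + c * (l * U₀ + B / l) + s * (V₀ + Y) := by
    rw [h1]; field_simp; ring
  have e2 : V = - s * (l * U₀ + B / l) + c * (V₀ + Y) := by
    rw [h2]; field_simp; ring
  have e3 : (l * U + B / l) ^ 2 + V ^ 2 = (l * U₀ + B / l) ^ 2 + (V₀ + Y) ^ 2 := by
    rw [e1, e2]
    linear_combination ((l * U₀ + B / l) ^ 2 + (V₀ + Y) ^ 2) * hcs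
  have e4 : ∀ x : ℝ, (l * x + B / l) ^ 2 = l ^ 2 * x ^ 2 + 2 * B * x + (B / l) ^ 2 := by
    intro x; field_simp; ring
  rw [e4, e4] at e3
  linear_combination e3

end Energy

end SAV

namespace SAV

/-! ### Measurability of the noise coefficients by spectral truncation -/

section NoiseMeasurability

variable {d : ℕ} {O : Set (EuclideanSpace ℝ (Fin d))} (S : DirichletEigenpairs O)

namespace DirichletEigenpairs

/-- The combination of the first `m` eigenfunctions with coefficients `c`. -/
noncomputable def modes (m : ℕ) (c : ℕ → ℝ) : L2 O := ∑ i ∈ Finset.range m, c i • S.e i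

lemma modes_sub (m : ℕ) (c c' : ℕ → ℝ) : S.modes m c - S.modes m c' = S.modes m (c - c') := by
  simp [modes, sub_smul, Finset.sum_sub_distrib]

lemma coord_modes (m : ℕ) (c : ℕ → ℝ) (i : ℕ) :
    ⟪S.e i, S.modes m c⟫ = if i < m then c i else 0 := by
  have h := orthonormal_iff_ite.1 S.e.orthonormal
  simp [modes, inner_sum, real_inner_smul_right, h]

lemma hasSum_modes (m : ℕ) (c : ℕ → ℝ) :
    HasSum (fun i => S.eig i * ⟪S.e i, S.modes m c⟫ ^ 2)
      (∑ i ∈ Finset.range m, S.eig i * c i ^ 2) := by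
  have h : ∑ i ∈ Finset.range m, S.eig i * c i ^ 2 =
      ∑ i ∈ Finset.range m, S.eig i * ⟪S.e i, S.modes m c⟫ ^ 2 :=
    Finset.sum_congr rfl fun i hi => by rw [coord_modes, if_pos (Finset.mem_range.1 hi)]
  rw [h]
  refine hasSum_sum_of_ne_finset_zero fun i hi => ?_
  rw [coord_modes, if_neg (by simpa using hi)]
  simp

lemma memH1_modes (m : ℕ) (c : ℕ → ℝ) : S.MemH1 (S.modes m c) := (S.hasSum_modes m c).summable

lemma normH1_modes (m : ℕ) (c : ℕ → ℝ) :
    S.normH1 (S.modes m c) = √(∑ i ∈ Finset.range m, S.eig i * c i ^ 2) := by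
  rw [normH1, (S.hasSum_modes m c).tsum_eq]

variable {S} in
lemma MemH1.normH1_sub_modes {u : L2 O} (hu : S.MemH1 u) (m : ℕ) :
    S.normH1 (u - S.modes m fun i => ⟪S.e i, u⟫) =
      √(S.normH1 u ^ 2 - ∑ i ∈ Finset.range m, S.eig i * ⟪S.e i, u⟫ ^ 2) := by
  have h := hu.hasSum.sub (S.hasSum_modes m fun i => ⟪S.e i, u⟫)
  rw [normH1, ← h.tsum_eq]
  congr 2
  ext i
  rw [inner_sub_right, coord_modes]
  split_ifs <;> ring

lemma measurable_coord {Ω : Type*} {_ : MeasurableSpace Ω} {u : Ω → L2 O}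
    (hu : StronglyMeasurable u) (i : ℕ) : Measurable fun ω => ⟪S.e i, u ω⟫ :=
  (stronglyMeasurable_const.inner hu).measurable

lemma measurable_normH1 {Ω : Type*} {_ : MeasurableSpace Ω} {u : Ω → L2 O}
    (hu : StronglyMeasurable u) : Measurable fun ω => S.normH1 (u ω) := by
  refine Measurable.sqrt (Measurable.tsum fun i => ?_)
  exact ((S.measurable_coord hu i).pow_const 2).const_mul _

end DirichletEigenpairs

variable {R : L2 O →L[ℝ] L2 O}

/-- Needed because `hsNorm` controls the columns only when its series converges; a divergent `tsum`
is `0`. -/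
lemma NoiseOp.IsHS.sub {G G' : NoiseOp R} (h : G.IsHS S) (h' : G'.IsHS S) : (G - G').IsHS S := by
  obtain ⟨⟨K, hK⟩, hs⟩ := h
  obtain ⟨⟨K', hK'⟩, hs'⟩ := h'
  refine ⟨⟨K + K', fun x => ?_⟩, ?_⟩
  · have : (G - G').at_ x = G.at_ x - G'.at_ x := rfl
    rw [this, add_mul]
    exact (norm_sub_le _ _).trans (add_le_add (hK x) (hK' x))
  · refine Summable.of_nonneg_of_le (fun _ => sq_nonneg _) (fun i => ?_)
      ((hs.mul_left 2).add (hs'.mul_left 2))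
    have h1 : ‖(G - G').at_ (S.e i)‖ ≤ ‖G.at_ (S.e i)‖ + ‖G'.at_ (S.e i)‖ := norm_sub_le _ _
    have h0 := norm_nonneg ((G - G').at_ (S.e i))
    nlinarith [sq_nonneg (‖G.at_ (S.e i)‖ - ‖G'.at_ (S.e i)‖)]

lemma NoiseOp.hsNorm_nonneg (G : NoiseOp R) : 0 ≤ G.hsNorm S := Real.sqrt_nonneg _

lemma NoiseOp.IsHS.sum_le {G : NoiseOp R} (h : G.IsHS S) (s : Finset ℕ) :
    ∑ i ∈ s, ‖G.at_ (S.e i)‖ ^ 2 ≤ G.hsNorm S ^ 2 := by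
  rw [NoiseOp.hsNorm, Real.sq_sqrt (tsum_nonneg fun _ => sq_nonneg _)]
  exact h.2.sum_le_tsum s fun _ _ => sq_nonneg _

lemma NoiseOp.IsHS.norm_at_le {G : NoiseOp R} (h : G.IsHS S) (i : ℕ) :
    ‖G.at_ (S.e i)‖ ≤ G.hsNorm S := by
  have := h.sum_le S {i}
  rw [Finset.sum_singleton] at this
  exact (sq_le_sq₀ (norm_nonneg _) (NoiseOp.hsNorm_nonneg S G)).1 this

namespace CoefficientAssumption

variable {S} {k : ℕ} {δ₀ : ℝ} {f Ft : ℝ → ℝ} {g : L2 O × (Fin d → L2 O) → NoiseOp R}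

lemma exists_lipschitz_at (h : CoefficientAssumption S k δ₀ f Ft g) (j : ℕ) :
    ∃ b : ℝ × ℝ → ℝ, Continuous b ∧ ∀ u u', S.MemH1 u → S.MemH1 u' →
      ‖(g (Theta u)).at_ (S.e j) - (g (Theta u')).at_ (S.e j)‖ ≤
        b (S.normH1 u, S.normH1 u') * S.normH1 (u - u') := by
  obtain ⟨b₃, -, hb⟩ := h.g_lipschitz
  refine ⟨fun x => MvPolynomial.eval ![x.1, x.2] b₃, ?_, fun u u' hu hu' => ?_⟩
  · refine (MvPolynomial.continuous_eval b₃).comp (continuous_pi fun i => ?_)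
    fin_cases i
    · exact continuous_fst
    · exact continuous_snd
  · exact (((h.g_hs u hu).sub S (h.g_hs u' hu')).norm_at_le S j).trans (hb u u' hu hu')

/-- Only finitely many coefficients enter, so the norm of `Ḣ¹` is continuous for the product
topology, and the local Lipschitz bound does the rest. -/
lemma continuous_at_modes (h : CoefficientAssumption S k δ₀ f Ft g) (j m : ℕ) :
    Continuous fun c : ℕ → ℝ => (g (Theta (S.modes m c))).at_ (S.e j) := by
  obtain ⟨b, hbc, hb⟩ := h.exists_lipschitz_at j
  refine continuous_iff_continuousAt.2 fun c₀ => tendsto_iff_norm_sub_tendsto_zero.2 ?_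
  refine squeeze_zero (fun _ => norm_nonneg _)
    (fun c => hb _ _ (S.memH1_modes m c) (S.memH1_modes m c₀)) ?_
  simp only [S.modes_sub, S.normH1_modes]
  refine Continuous.tendsto' (by fun_prop) c₀ 0 (by simp)

/-- Truncations converge in `Ḣ¹`, the error being the tail of the norm series, and the Lipschitz
factor converges along them. -/
lemma tendsto_at_modes (h : CoefficientAssumption S k δ₀ f Ft g) (j : ℕ) {u : L2 O}
    (hu : S.MemH1 u) :
    Tendsto (fun m => (g (Theta (S.modes m fun i => ⟪S.e i, u⟫))).at_ (S.e j)) atTop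
      (𝓝 ((g (Theta u)).at_ (S.e j))) := by
  obtain ⟨b, hbc, hb⟩ := h.exists_lipschitz_at j
  refine tendsto_iff_norm_sub_tendsto_zero.2 (squeeze_zero (fun _ => norm_nonneg _)
    (fun m => (norm_sub_rev _ _).le.trans (hb u _ hu (S.memH1_modes m _))) ?_)
  simp only [hu.normH1_sub_modes, S.normH1_modes]
  have h1 := hu.hasSum.tendsto_sum_nat
  have h2 := (hbc.tendsto (S.normH1 u, √(S.normH1 u ^ 2))).comp
    (tendsto_const_nhds.prodMk_nhds h1.sqrt)
  have h3 := (h1.const_sub (S.normH1 u ^ 2)).sqrt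
  simpa using h2.mul h3

/-- The noise coefficients along a process in `Ḣ¹` possess versions that are measurable with
respect to the process. -/
lemma exists_measurable_at (h : CoefficientAssumption S k δ₀ f Ft g) {Ω : Type*}
    {mΩ : MeasurableSpace Ω} {u : Ω → L2 O} (hu : StronglyMeasurable u) (j : ℕ) :
    ∃ G : Ω → L2 O, StronglyMeasurable G ∧
      ∀ ω, S.MemH1 (u ω) → G ω = (g (Theta (u ω))).at_ (S.e j) := by
  -- Measurability of `u` refers to `L²`, whereas `g` is continuous only for `Ḣ¹`. The truncations
  -- depend continuously on the coordinates, and `limUnder` stays measurable even where no limit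
  -- exists.
  refine ⟨fun ω => limUnder atTop fun m =>
    (g (Theta (S.modes m fun i => ⟪S.e i, u ω⟫))).at_ (S.e j),
    StronglyMeasurable.limUnder fun m => ?_, fun ω hω => (h.tendsto_at_modes j hω).limUnder_eq⟩
  exact (h.continuous_at_modes j m).comp_stronglyMeasurable
    (measurable_pi_iff.2 (S.measurable_coord hu)).stronglyMeasurable

end CoefficientAssumption

end NoiseMeasurability

end SAV

namespace SAV

/-! ### Second-order expansion of powers with an explicit linear term -/

section PowerInequality

lemma pow_le_sq_add_pow (x : ℝ) {p j : ℕ} (hj : 2 ≤ j) (hjp : j ≤ p) :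
    x ^ j ≤ x ^ 2 + x ^ (2 * p) := by
  have h1 : x ^ j ≤ |x| ^ j := by rw [← abs_pow]; exact le_abs_self _
  have h2 : x ^ 2 = |x| ^ 2 := (sq_abs x).symm
  have h3 : x ^ (2 * p) = |x| ^ (2 * p) := by rw [pow_mul, pow_mul, sq_abs]
  rw [h2, h3]
  rcases le_total |x| 1 with h | h
  · exact h1.trans ((pow_le_pow_of_le_one (abs_nonneg x) h hj).trans
      (le_add_of_nonneg_right (by positivity)))
  · exact h1.trans ((pow_le_pow_right₀ h (by omega)).trans
      (le_add_of_nonneg_left (by positivity)))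

/-- In the binomial expansion the linear term is kept exactly, since it will average to zero; every
higher power lies below `x² + x^{2p}`, and the coefficients sum to `2^p`. -/
lemma one_add_pow_le (p : ℕ) (x : ℝ) :
    (1 + x) ^ p ≤ 1 + p * x + 2 ^ p * (x ^ 2 + x ^ (2 * p)) := by
  have hx : 0 ≤ x ^ 2 + x ^ (2 * p) := by rw [pow_mul]; positivity
  have hterm : ∀ j ∈ Finset.range (p + 1), x ^ j * 1 ^ (p - j) * (p.choose j : ℝ) ≤
      (if j = 0 then 1 else 0) + (if j = 1 then p * x else 0) +
        (p.choose j : ℝ) * (x ^ 2 + x ^ (2 * p)) := by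
    intro j hj
    have hc : 0 ≤ (p.choose j : ℝ) * (x ^ 2 + x ^ (2 * p)) := by positivity
    rcases j with _ | _ | j
    · simpa using hx
    · simp only [one_pow, mul_one, pow_one, zero_add, Nat.choose_one_right] at hc ⊢
      simp only [one_ne_zero, if_false, if_true]
      linarith
    · have := pow_le_sq_add_pow x (j := j + 1 + 1) (p := p) (by omega)
        (by rw [Finset.mem_range] at hj; omega)
      have h2 : (0 : ℝ) ≤ (p.choose (j + 1 + 1) : ℝ) := by positivity
      simp only [one_pow, mul_one, Nat.add_eq_zero_iff, one_ne_zero, and_false, if_false,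
        Nat.add_eq_right, zero_add]
      rw [mul_comm]
      exact mul_le_mul_of_nonneg_left this h2
  have hsum := Finset.sum_le_sum hterm
  rw [← add_pow, Finset.sum_add_distrib, Finset.sum_add_distrib, ← Finset.sum_mul] at hsum
  have hch : ∑ j ∈ Finset.range (p + 1), (p.choose j : ℝ) = 2 ^ p := by
    exact_mod_cast Nat.sum_range_choose p
  rw [hch, add_comm x 1, Finset.sum_ite_eq', Finset.sum_ite_eq'] at hsum
  refine hsum.trans (le_of_eq ?_)
  rcases p with _ | p <;> simp

/-- The function `x ↦ η + η^{r+1}`, `η = x² + x⁴`. -/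
noncomputable def momentWeight (r : ℕ) (x : ℝ) : ℝ := (x ^ 2 + x ^ 4) + (x ^ 2 + x ^ 4) ^ (r + 1)

/-- The constant in `pow_perturbation_le`. -/
noncomputable def stepConst (r : ℕ) (K : ℝ) : ℝ :=
  (r + 1) + 2 ^ (r + 1) * ((4 + K) + K ^ r * (4 + K) ^ (r + 1))

lemma stepConst_nonneg (r : ℕ) {K : ℝ} (hK : 0 ≤ K) : 0 ≤ stepConst r K := by
  unfold stepConst; positivity

lemma momentWeight_nonneg (r : ℕ) (x : ℝ) : 0 ≤ momentWeight r x := by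
  unfold momentWeight; positivity

/-- After division by `Z` the relative perturbation `x` satisfies `x² ≤ α (4 + K) η`. The remainder
must be linear in `α`, because the `α` of all modes will be summed. -/
lemma pow_perturbation_le (r : ℕ) {Z b c α K : ℝ} (ξ : ℝ) (hZ : 0 < Z) (hα : 0 ≤ α) (hαK : α ≤ K)
    (hb : b ^ 2 ≤ 2 * α * Z ^ 2) (hc : 0 ≤ c) (hcZ : c ≤ α / 2 * Z) :
    (Z + b * ξ + c * ξ ^ 2) ^ (r + 1) ≤ Z ^ (r + 1) + (r + 1) * (Z ^ r * b) * ξ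
      + stepConst r K * (α * Z ^ (r + 1)) * momentWeight r ξ := by
  set x := (b * ξ + c * ξ ^ 2) / Z with hx
  set η := ξ ^ 2 + ξ ^ 4 with hη
  have hη0 : 0 ≤ η := by positivity
  have hK : 0 ≤ K := hα.trans hαK
  have hxZ : Z + b * ξ + c * ξ ^ 2 = Z * (1 + x) := by rw [hx]; field_simp; ring
  have hξη : ξ ^ 2 ≤ η := le_add_of_nonneg_right (by positivity)
  have hξη' : ξ ^ 4 ≤ η := le_add_of_nonneg_left (by positivity)
  have hc2 : c ^ 2 ≤ (α / 2 * Z) ^ 2 := by gcongr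
  have hx2 : x ^ 2 ≤ α * (4 + K) * η := by
    rw [hx, div_pow, div_le_iff₀ (by positivity)]
    calc (b * ξ + c * ξ ^ 2) ^ 2 ≤ 2 * (b ^ 2 * ξ ^ 2) + 2 * (c ^ 2 * ξ ^ 4) := by
          nlinarith [sq_nonneg (b * ξ - c * ξ ^ 2)]
      _ ≤ 2 * (2 * α * Z ^ 2 * η) + 2 * ((α / 2 * Z) ^ 2 * η) := by gcongr
      _ = α * (4 + α / 2) * η * Z ^ 2 := by ring
      _ ≤ α * (4 + K) * η * Z ^ 2 := by gcongr; linarith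
  -- One factor `α` is kept and the other `r` are replaced by `K`.
  have hxp : x ^ (2 * (r + 1)) ≤ α * (K ^ r * (4 + K) ^ (r + 1)) * η ^ (r + 1) := by
    calc x ^ (2 * (r + 1)) = (x ^ 2) ^ (r + 1) := pow_mul _ _ _
      _ ≤ (α * (4 + K) * η) ^ (r + 1) := by gcongr
      _ = α * (α ^ r * (4 + K) ^ (r + 1)) * η ^ (r + 1) := by
        rw [mul_pow, mul_pow, pow_succ' α]; ring
      _ ≤ _ := by gcongr
  have hmain := one_add_pow_le (r + 1) x
  have hcx : c * ξ ^ 2 / Z ≤ α * η := by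
    rw [div_le_iff₀ hZ]
    calc c * ξ ^ 2 ≤ (α / 2 * Z) * η := by gcongr
      _ ≤ _ := by nlinarith [mul_nonneg (mul_nonneg hα hη0) hZ.le]
  have hxle : x ≤ b * ξ / Z + α * η := by rw [hx, add_div]; linarith
  have hηp : 0 ≤ η ^ (r + 1) := by positivity
  have hbound : (1 + x) ^ (r + 1) ≤ 1 + (r + 1) * (b * ξ / Z)
      + stepConst r K * α * momentWeight r ξ := by
    have h1 : ((r + 1 : ℕ) : ℝ) * x ≤ (r + 1) * (b * ξ / Z) + (r + 1) * (α * η) := by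
      push_cast
      rw [← mul_add]
      gcongr
    have h2 : (2 : ℝ) ^ (r + 1) * (x ^ 2 + x ^ (2 * (r + 1))) ≤
        2 ^ (r + 1) * (α * (4 + K) * η + α * (K ^ r * (4 + K) ^ (r + 1)) * η ^ (r + 1)) := by
      gcongr
    have h3 : (r + 1) * (α * η) + 2 ^ (r + 1) * (α * (4 + K) * η
        + α * (K ^ r * (4 + K) ^ (r + 1)) * η ^ (r + 1)) ≤
        stepConst r K * α * momentWeight r ξ := by
      have e : stepConst r K * α * momentWeight r ξ - ((r + 1) * (α * η) + 2 ^ (r + 1) *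
          (α * (4 + K) * η + α * (K ^ r * (4 + K) ^ (r + 1)) * η ^ (r + 1))) =
          α * ((r + 1) * η ^ (r + 1) + 2 ^ (r + 1) * (4 + K) * η ^ (r + 1)
            + 2 ^ (r + 1) * (K ^ r * (4 + K) ^ (r + 1)) * η) := by
        rw [stepConst, momentWeight, ← hη]; ring
      have : 0 ≤ α * ((r + 1) * η ^ (r + 1) + 2 ^ (r + 1) * (4 + K) * η ^ (r + 1)
            + 2 ^ (r + 1) * (K ^ r * (4 + K) ^ (r + 1)) * η) := by positivity
      linarith
    linarith
  rw [hxZ, mul_pow]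
  calc Z ^ (r + 1) * (1 + x) ^ (r + 1) ≤ Z ^ (r + 1) * (1 + (r + 1) * (b * ξ / Z)
      + stepConst r K * α * momentWeight r ξ) := by gcongr
    _ = _ := by
      have : Z ^ (r + 1) * (b * ξ / Z) = Z ^ r * b * ξ := by field_simp; ring
      linear_combination (r + 1 : ℝ) * this

end PowerInequality

/-! ### Gaussian moments of order `τ` -/

section Gaussian

lemma integrable_pow_gaussianReal (τ : ℝ≥0) (n : ℕ) (hn : n ≠ 0) :
    Integrable (fun x : ℝ => x ^ n) (gaussianReal 0 τ) := by
  have h := (memLp_id_gaussianReal' (μ := 0) (v := τ) n (by simp)).integrable_norm_pow hn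
  refine h.mono' (by fun_prop) (ae_of_all _ fun x => ?_)
  simp

lemma measurable_momentWeight (r : ℕ) : Measurable (momentWeight r) := by
  unfold momentWeight; fun_prop

lemma integrable_momentWeight (r : ℕ) (τ : ℝ≥0) :
    Integrable (momentWeight r) (gaussianReal 0 τ) := by
  have h2 := integrable_pow_gaussianReal τ 2 (by norm_num)
  have h4 := integrable_pow_gaussianReal τ 4 (by norm_num)
  refine (h2.add h4).add ?_
  refine Integrable.mono' (((integrable_pow_gaussianReal τ (2 * (r + 1)) (by omega)).add
    (integrable_pow_gaussianReal τ (4 * (r + 1)) (by omega))).const_mul (2 ^ r))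
    (by fun_prop) (ae_of_all _ fun x => ?_)
  rw [Real.norm_of_nonneg (by positivity)]
  simpa [pow_mul] using add_pow_le (sq_nonneg x) (by positivity : 0 ≤ x ^ 4) (r + 1)

/-- All terms of `momentWeight` are at least quadratic, so scaling a standard Gaussian by `√τ`
produces a factor `τ`; surplus powers of `τ` are absorbed by powers of `1 + T`. -/
lemma exists_integral_momentWeight_le (r : ℕ) (T : ℝ≥0) :
    ∃ M : ℝ, 0 ≤ M ∧ ∀ τ : ℝ≥0, τ ≤ T → ∫ x, momentWeight r x ∂gaussianReal 0 τ ≤ M * τ := by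
  refine ⟨(1 + T) ^ (2 * r + 1) * ∫ x, momentWeight r x ∂gaussianReal 0 1,
    mul_nonneg (by positivity) (integral_nonneg (momentWeight_nonneg r)), fun τ hτ => ?_⟩
  have hmap : gaussianReal 0 τ = (gaussianReal 0 1).map (√τ * ·) := by
    rw [gaussianReal_map_const_mul]
    congr 1
    · simp
    · ext
      simp
  have hT : (τ : ℝ) ≤ T := hτ
  rw [hmap, integral_map (by fun_prop) (measurable_momentWeight r).aestronglyMeasurable,
    mul_right_comm, ← integral_const_mul]
  refine integral_mono_of_nonneg (ae_of_all _ fun x => momentWeight_nonneg r _)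
    ((integrable_momentWeight r 1).const_mul _) (ae_of_all _ fun x => ?_)
  have hs : √(τ : ℝ) ^ 2 = τ := Real.sq_sqrt τ.2
  have hs4 : √(τ : ℝ) ^ 4 = τ ^ 2 := by
    rw [show 4 = 2 * 2 from rfl, pow_mul, hs]
  have h1 : (√(τ : ℝ) * x) ^ 2 + (√(τ : ℝ) * x) ^ 4 ≤ τ * (1 + T) * (x ^ 2 + x ^ 4) := by
    rw [mul_pow, mul_pow, hs, hs4]
    have hx2 : 0 ≤ (τ : ℝ) * T * x ^ 2 := by positivity
    have hx4 : (τ : ℝ) ^ 2 * x ^ 4 ≤ τ * (1 + T) * x ^ 4 := by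
      rw [sq]; gcongr; linarith
    nlinarith
  have hT1 : (1 : ℝ) ≤ 1 + T := le_add_of_nonneg_right T.2
  have h2 : (τ * (1 + T) * (x ^ 2 + x ^ 4)) ^ (r + 1) ≤
      (1 + T) ^ (2 * r + 1) * τ * (x ^ 2 + x ^ 4) ^ (r + 1) := by
    have : (τ : ℝ) ^ r ≤ (1 + T) ^ r := by gcongr; linarith
    calc (τ * (1 + T) * (x ^ 2 + x ^ 4)) ^ (r + 1)
        = τ ^ r * ((1 + T) ^ (r + 1) * τ * (x ^ 2 + x ^ 4) ^ (r + 1)) := by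
          rw [mul_pow, mul_pow, pow_succ' (τ : ℝ)]; ring
      _ ≤ (1 + T) ^ r * ((1 + T) ^ (r + 1) * τ * (x ^ 2 + x ^ 4) ^ (r + 1)) := by gcongr
      _ = _ := by ring
  have h3 : τ * (1 + T) * (x ^ 2 + x ^ 4) ≤ (1 + T) ^ (2 * r + 1) * τ * (x ^ 2 + x ^ 4) := by
    rw [mul_comm (τ : ℝ)]
    gcongr
    exact le_self_pow₀ hT1 (by omega)
  calc momentWeight r (√τ * x) ≤ τ * (1 + T) * (x ^ 2 + x ^ 4)
        + (τ * (1 + T) * (x ^ 2 + x ^ 4)) ^ (r + 1) := by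
        unfold momentWeight; gcongr
    _ ≤ (1 + T) ^ (2 * r + 1) * τ * momentWeight r x := by
        unfold momentWeight; linarith

end Gaussian

/-! ### Independence of a new mode from the past and the earlier modes -/

section Independence

lemma generateFrom_inter_eq_sup {Ω : Type*} (m₁ m₂ : MeasurableSpace Ω) :
    m₁ ⊔ m₂ = MeasurableSpace.generateFrom
      {s | ∃ s₁ s₂, MeasurableSet[m₁] s₁ ∧ MeasurableSet[m₂] s₂ ∧ s = s₁ ∩ s₂} := by
  refine le_antisymm (sup_le (fun s hs => ?_) (fun s hs => ?_))
    (MeasurableSpace.generateFrom_le ?_)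
  · exact MeasurableSpace.measurableSet_generateFrom
      ⟨s, Set.univ, hs, MeasurableSet.univ, (Set.inter_univ s).symm⟩
  · exact MeasurableSpace.measurableSet_generateFrom
      ⟨Set.univ, s, MeasurableSet.univ, hs, (Set.univ_inter s).symm⟩
  · rintro _ ⟨s₁, s₂, h₁, h₂, rfl⟩
    exact MeasurableSet.inter (le_sup_left (a := m₁) _ h₁) (le_sup_right (a := m₁) _ h₂)

/-- For `m₁` the past, `m₄` all the increments, `m₂` the modes already used and `m₃` the next one:
on the π-system of intersections, `m₁` is split off first and then `m₂` from `m₃` inside `m₄`. -/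
lemma indep_sup_of_indep {Ω : Type*} {mΩ : MeasurableSpace Ω} {P : Measure Ω}
    [IsProbabilityMeasure P] {m₁ m₂ m₃ m₄ : MeasurableSpace Ω} (h₁ : m₁ ≤ mΩ) (h₄ : m₄ ≤ mΩ)
    (h₂₄ : m₂ ≤ m₄) (h₃₄ : m₃ ≤ m₄) (h : Indep m₄ m₁ P) (h' : Indep m₂ m₃ P) :
    Indep (m₁ ⊔ m₂) m₃ P := by
  refine IndepSets.indep (sup_le h₁ (h₂₄.trans h₄)) (h₃₄.trans h₄) ?_
    (@MeasurableSpace.isPiSystem_measurableSet Ω m₃) (generateFrom_inter_eq_sup m₁ m₂)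
    (@MeasurableSpace.generateFrom_measurableSet Ω m₃).symm ?_
  · rintro _ ⟨s₁, s₂, hs₁, hs₂, rfl⟩ _ ⟨t₁, t₂, ht₁, ht₂, rfl⟩ -
    exact ⟨s₁ ∩ t₁, s₂ ∩ t₂, MeasurableSet.inter hs₁ ht₁, MeasurableSet.inter hs₂ ht₂,
      Set.inter_inter_inter_comm _ _ _ _⟩
  · rw [IndepSets_iff]
    rintro _ t ⟨s₁, s₂, hs₁, hs₂, rfl⟩ ht
    rw [Indep_iff] at h h'
    have e : s₁ ∩ s₂ ∩ t = (s₂ ∩ t) ∩ s₁ := by rw [Set.inter_assoc, Set.inter_comm]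
    rw [e, h _ _ (MeasurableSet.inter (h₂₄ _ hs₂) (h₃₄ _ ht)) hs₁, h' _ _ hs₂ ht,
      Set.inter_comm s₁ s₂, h _ _ (h₂₄ _ hs₂) hs₁]
    ring

end Independence

end SAV

namespace SAV

/-! ### Moments of the energy under one Hilbert-space noise increment -/

section NoiseMoments

/-- Fatou's lemma. Integrability is part of the conclusion because the Bochner integral of a
non-integrable function is `0`. -/
lemma integrable_and_integral_le_of_tendsto {Ω : Type*} {mΩ : MeasurableSpace Ω} {P : Measure Ω}
    {F : ℕ → Ω → ℝ} {f : Ω → ℝ} {C : ℝ} (hF : ∀ n, Integrable (F n) P) (h0 : ∀ n ω, 0 ≤ F n ω)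
    (hC : ∀ n, ∫ ω, F n ω ∂P ≤ C) (hlim : ∀ᵐ ω ∂P, Tendsto (fun n => F n ω) atTop (𝓝 (f ω))) :
    Integrable f P ∧ ∫ ω, f ω ∂P ≤ C := by
  have hf : AEStronglyMeasurable f P :=
    aestronglyMeasurable_of_tendsto_ae atTop (fun n => (hF n).aestronglyMeasurable) hlim
  have hf0 : 0 ≤ᵐ[P] f := by
    filter_upwards [hlim] with ω hω
    exact ge_of_tendsto' hω fun n => h0 n ω
  have hC0 : 0 ≤ C := (integral_nonneg (h0 0)).trans (hC 0)
  have hle : ∫⁻ ω, ENNReal.ofReal (f ω) ∂P ≤ ENNReal.ofReal C := by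
    calc ∫⁻ ω, ENNReal.ofReal (f ω) ∂P
        = ∫⁻ ω, liminf (fun n => ENNReal.ofReal (F n ω)) atTop ∂P := by
          refine lintegral_congr_ae ?_
          filter_upwards [hlim] with ω hω
          exact ((ENNReal.continuous_ofReal.tendsto _).comp hω).liminf_eq.symm
      _ ≤ liminf (fun n => ∫⁻ ω, ENNReal.ofReal (F n ω) ∂P) atTop :=
          lintegral_liminf_le' fun n => (hF n).aemeasurable.ennreal_ofReal
      _ ≤ ENNReal.ofReal C := by
          refine liminf_le_of_le (by isBoundedDefault) fun b hb => ?_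
          obtain ⟨n, hn⟩ := hb.exists
          refine hn.trans ?_
          rw [← ofReal_integral_eq_lintegral_ofReal (hF n) (ae_of_all _ (h0 n))]
          exact ENNReal.ofReal_le_ofReal (hC n)
  refine ⟨⟨hf, ?_⟩, ?_⟩
  · rw [hasFiniteIntegral_iff_ofReal hf0]
    exact hle.trans_lt ENNReal.ofReal_lt_top
  · rw [integral_eq_lintegral_of_nonneg_ae hf0 hf]
    exact ENNReal.toReal_le_of_le_ofReal hC0 hle

variable {H : Type*} [NormedAddCommGroup H] {Ω : Type*} {mΩ : MeasurableSpace Ω} {P : Measure Ω}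

lemma comap_pi_le {ι Ω' : Type*} {m : MeasurableSpace Ω'} {ξ : ι → Ω' → ℝ}
    (h : ∀ k, Measurable (ξ k)) :
    MeasurableSpace.comap (fun ω k => ξ k ω) inferInstance ≤ m :=
  measurable_iff_comap_le.1 (measurable_pi_iff.2 h)

/-- The σ-algebra generated by `𝒢` and the first `m` variables `ξ_k`. -/
@[reducible]
def noisePast (𝒢 : MeasurableSpace Ω) (ξ : ℕ → Ω → ℝ) (m : ℕ) : MeasurableSpace Ω :=
  𝒢 ⊔ MeasurableSpace.comap (fun ω (k : Finset.range m) => ξ k ω) inferInstance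

/-- The assumptions on the data of one step with noise term `∑_k ξ_k G_k`. -/
structure IsNoiseData (P : Measure Ω) (𝒢 : MeasurableSpace Ω) (τ : ℝ≥0) (K : ℝ) (a : Ω → ℝ)
    (v : Ω → H) (ξ : ℕ → Ω → ℝ) (G : ℕ → Ω → H) : Prop where
  le : 𝒢 ≤ mΩ
  measurable_ξ : ∀ k, Measurable[mΩ] (ξ k)
  law : ∀ k, HasLaw (ξ k) (gaussianReal 0 τ) P
  indep : iIndepFun ξ P
  indep_past : Indep (MeasurableSpace.comap (fun ω k => ξ k ω) inferInstance) 𝒢 P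
  measurable_a : Measurable[𝒢] a
  measurable_v : StronglyMeasurable[𝒢] v
  measurable_G : ∀ k, StronglyMeasurable[𝒢] (G k)
  one_le : ∀ ω, 1 ≤ a ω
  bound : ∀ᵐ ω ∂P, ∀ m, ∑ k ∈ Finset.range m, ‖G k ω‖ ^ 2 ≤ K * a ω

namespace IsNoiseData

variable {𝒢 : MeasurableSpace Ω} {τ : ℝ≥0} {K : ℝ} {a : Ω → ℝ} {v : Ω → H}
  {ξ : ℕ → Ω → ℝ} {G : ℕ → Ω → H}

lemma noisePast_le (h : IsNoiseData P 𝒢 τ K a v ξ G) (m : ℕ) : noisePast 𝒢 ξ m ≤ mΩ :=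
  sup_le h.le (comap_pi_le fun k => h.measurable_ξ k)

lemma indep_noisePast [IsProbabilityMeasure P] (h : IsNoiseData P 𝒢 τ K a v ξ G) (m : ℕ) :
    Indep (noisePast 𝒢 ξ m) (MeasurableSpace.comap (ξ m) inferInstance) P := by
  have hall : Measurable[MeasurableSpace.comap (fun ω k => ξ k ω) inferInstance]
      (fun ω (k : ℕ) => ξ k ω) := comap_measurable _
  refine indep_sup_of_indep h.le
    (comap_pi_le fun k => h.measurable_ξ k) ?_ ?_
    h.indep_past ?_
  · exact comap_pi_le fun k => (measurable_pi_apply (k : ℕ)).comp hall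
  · exact measurable_iff_comap_le.1 ((measurable_pi_apply m).comp hall)
  · have h1 := h.indep.indepFun_finset (Finset.range m) {m} (by simp) h.measurable_ξ
    have h2 := h1.comp measurable_id
      (measurable_pi_apply (⟨m, Finset.mem_singleton_self m⟩ : ({m} : Finset ℕ)))
    exact (IndepFun_iff_Indep _ _ _).1 h2

lemma indepFun [IsProbabilityMeasure P] (h : IsNoiseData P 𝒢 τ K a v ξ G) {m : ℕ} {X : Ω → ℝ}
    (hX : Measurable[noisePast 𝒢 ξ m] X) : IndepFun X (ξ m) P :=
  (IndepFun_iff_Indep _ _ _).2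
    (indep_of_indep_of_le_left (h.indep_noisePast m) (measurable_iff_comap_le.1 hX))

/-- The density that compensates for the growth of the energy. -/
noncomputable def damping (c : ℝ) (a : Ω → ℝ) (G : ℕ → Ω → H) (m : ℕ) (ω : Ω) : ℝ :=
  Real.exp (-(c * ∑ k ∈ Finset.range m, ‖G k ω‖ ^ 2 / a ω))

lemma measurable_damping (h : IsNoiseData P 𝒢 τ K a v ξ G) (c : ℝ) (m : ℕ) :
    Measurable[𝒢] (damping c a G m) := by
  refine Real.measurable_exp.comp (Measurable.neg (Measurable.const_mul ?_ c))
  exact Finset.measurable_fun_sum _ fun k _ =>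
    ((h.measurable_G k).norm.measurable.pow_const 2).div h.measurable_a

/-- From `1 + x ≤ exp x`. The weight is random because the ratios `‖G k ω‖ ^ 2 / a ω` are: their sum
is bounded pointwise, but the sum of their suprema need not be. -/
lemma damping_succ_mul_le {c : ℝ} (m : ℕ) (ω : Ω) :
    damping c a G (m + 1) ω * (1 + c * (‖G m ω‖ ^ 2 / a ω)) ≤ damping c a G m ω := by
  rw [damping, damping, Finset.sum_range_succ, mul_add c, neg_add, Real.exp_add, mul_assoc]
  refine mul_le_of_le_one_right (Real.exp_nonneg _) ?_
  rw [Real.exp_neg, inv_mul_le_iff₀ (Real.exp_pos _), mul_one, add_comm]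
  exact Real.add_one_le_exp _

lemma damping_le_one (h : IsNoiseData P 𝒢 τ K a v ξ G) {c : ℝ} (hc : 0 ≤ c) (m : ℕ) (ω : Ω) :
    damping c a G m ω ≤ 1 := by
  have ha : 0 < a ω := zero_lt_one.trans_le (h.one_le ω)
  refine Real.exp_le_one_iff.2 (neg_nonpos.2 (mul_nonneg hc (Finset.sum_nonneg fun k _ => ?_)))
  positivity

lemma norm_damping_le_one (h : IsNoiseData P 𝒢 τ K a v ξ G) {c : ℝ} (hc : 0 ≤ c) (m : ℕ) (ω : Ω) :
    ‖damping c a G m ω‖ ≤ 1 := by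
  rw [damping, Real.norm_of_nonneg (Real.exp_nonneg _)]
  exact h.damping_le_one hc m ω

/-- The Hilbert–Schmidt bound limits the total exponent, so the lower bound does not depend on `m`.
-/
lemma le_damping (h : IsNoiseData P 𝒢 τ K a v ξ G) {c : ℝ} (hc : 0 ≤ c) (m : ℕ) :
    ∀ᵐ ω ∂P, Real.exp (-(c * K)) ≤ damping c a G m ω := by
  filter_upwards [h.bound] with ω hω
  have ha : 0 < a ω := zero_lt_one.trans_le (h.one_le ω)
  refine Real.exp_le_exp.2 (neg_le_neg (mul_le_mul_of_nonneg_left ?_ hc))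
  rw [← Finset.sum_div, div_le_iff₀ ha]
  exact hω m

lemma integrable_noise (h : IsNoiseData P 𝒢 τ K a v ξ G) (m : ℕ) : Integrable (ξ m) P := by
  have h1 := integrable_pow_gaussianReal τ 1 (by norm_num)
  simp only [pow_one] at h1
  rw [← (h.law m).map_eq] at h1
  exact h1.comp_measurable (h.measurable_ξ m)

lemma integral_noise (h : IsNoiseData P 𝒢 τ K a v ξ G) (m : ℕ) : ∫ ω, ξ m ω ∂P = 0 := by
  rw [(h.law m).integral_eq, integral_id_gaussianReal]

lemma integrable_momentWeight_noise (h : IsNoiseData P 𝒢 τ K a v ξ G) (r m : ℕ) :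
    Integrable (fun ω => momentWeight r (ξ m ω)) P := by
  have h1 := integrable_momentWeight r τ
  rw [← (h.law m).map_eq] at h1
  exact h1.comp_measurable (h.measurable_ξ m)

lemma integral_momentWeight_noise (h : IsNoiseData P 𝒢 τ K a v ξ G) (r m : ℕ) :
    ∫ ω, momentWeight r (ξ m ω) ∂P = ∫ x, momentWeight r x ∂gaussianReal 0 τ := by
  rw [← (h.law m).map_eq, integral_map (h.measurable_ξ m).aemeasurable
    (measurable_momentWeight r).aestronglyMeasurable]

end IsNoiseData

variable [InnerProductSpace ℝ H]

/-- The energy `a + ½ ‖v + ∑_{k<m} ξ_k G_k‖²`. -/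
noncomputable def noiseEnergy (a : Ω → ℝ) (v : Ω → H) (ξ : ℕ → Ω → ℝ) (G : ℕ → Ω → H) (m : ℕ)
    (ω : Ω) : ℝ :=
  a ω + 1 / 2 * ‖v ω + ∑ k ∈ Finset.range m, ξ k ω • G k ω‖ ^ 2

namespace IsNoiseData

variable {𝒢 : MeasurableSpace Ω} {τ : ℝ≥0} {K : ℝ} {a : Ω → ℝ} {v : Ω → H}
  {ξ : ℕ → Ω → ℝ} {G : ℕ → Ω → H}

lemma stronglyMeasurable_velocity (h : IsNoiseData P 𝒢 τ K a v ξ G) (m : ℕ) :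
    StronglyMeasurable[noisePast 𝒢 ξ m]
      (fun ω => v ω + ∑ k ∈ Finset.range m, ξ k ω • G k ω) := by
  have hle : 𝒢 ≤ noisePast 𝒢 ξ m := le_sup_left
  refine (h.measurable_v.mono hle).add (Finset.stronglyMeasurable_fun_sum _ fun k hk => ?_)
  have hall : Measurable[noisePast 𝒢 ξ m] (fun ω (k : Finset.range m) => ξ k ω) :=
    (comap_measurable _).mono le_sup_right le_rfl
  have hk' : Measurable[noisePast 𝒢 ξ m] (ξ k) :=
    (measurable_pi_apply (⟨k, hk⟩ : Finset.range m)).comp hall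
  exact hk'.stronglyMeasurable.smul ((h.measurable_G k).mono hle)

lemma measurable_noiseEnergy (h : IsNoiseData P 𝒢 τ K a v ξ G) (m : ℕ) :
    Measurable[noisePast 𝒢 ξ m] (noiseEnergy a v ξ G m) :=
  (h.measurable_a.mono le_sup_left le_rfl).add
    (((h.stronglyMeasurable_velocity m).norm.measurable.pow_const 2).const_mul (1 / 2))

lemma le_noiseEnergy (a : Ω → ℝ) (v : Ω → H) (ξ : ℕ → Ω → ℝ) (G : ℕ → Ω → H) (m : ℕ) (ω : Ω) :
    a ω ≤ noiseEnergy a v ξ G m ω :=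
  le_add_of_nonneg_right (by positivity)

lemma noiseEnergy_nonneg (h : IsNoiseData P 𝒢 τ K a v ξ G) (m : ℕ) (ω : Ω) :
    0 ≤ noiseEnergy a v ξ G m ω :=
  zero_le_one.trans ((h.one_le ω).trans (le_noiseEnergy a v ξ G m ω))

/-- The coefficient of the linear term in the increment of the energy. -/
noncomputable def drift (v : Ω → H) (ξ : ℕ → Ω → ℝ) (G : ℕ → Ω → H) (m : ℕ) (ω : Ω) : ℝ :=
  ⟪v ω + ∑ k ∈ Finset.range m, ξ k ω • G k ω, G m ω⟫

lemma measurable_drift (h : IsNoiseData P 𝒢 τ K a v ξ G) (m : ℕ) :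
    Measurable[noisePast 𝒢 ξ m] (drift v ξ G m) :=
  ((h.stronglyMeasurable_velocity m).inner ((h.measurable_G m).mono le_sup_left)).measurable

lemma noiseEnergy_succ (m : ℕ) (ω : Ω) :
    noiseEnergy a v ξ G (m + 1) ω = noiseEnergy a v ξ G m ω + drift v ξ G m ω * ξ m ω
      + (‖G m ω‖ ^ 2 / 2) * ξ m ω ^ 2 := by
  simp only [noiseEnergy, drift, Finset.sum_range_succ]
  rw [← add_assoc, norm_add_sq_real, real_inner_smul_right, norm_smul, mul_pow, Real.norm_eq_abs,
    sq_abs]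
  ring

/-- Cauchy–Schwarz and `‖x‖² a ≤ 2 (a + ½ ‖x‖²)²`. Dividing by `a` instead of the current energy
keeps the ratio `𝒢`-measurable and its sum over the modes bounded. -/
lemma sq_drift_le (h : IsNoiseData P 𝒢 τ K a v ξ G) (m : ℕ) (ω : Ω) :
    drift v ξ G m ω ^ 2 ≤ 2 * (‖G m ω‖ ^ 2 / a ω) * noiseEnergy a v ξ G m ω ^ 2 := by
  have ha : 0 < a ω := zero_lt_one.trans_le (h.one_le ω)
  set x := v ω + ∑ k ∈ Finset.range m, ξ k ω • G k ω with hx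
  have hZ : noiseEnergy a v ξ G m ω = a ω + 1 / 2 * ‖x‖ ^ 2 := rfl
  have h1 : drift v ξ G m ω ^ 2 ≤ ‖x‖ ^ 2 * ‖G m ω‖ ^ 2 := by
    rw [← mul_pow, ← sq_abs]
    exact pow_le_pow_left₀ (abs_nonneg _) (abs_real_inner_le_norm _ _) 2
  refine h1.trans ?_
  have h2 : ‖x‖ ^ 2 * a ω ≤ 2 * noiseEnergy a v ξ G m ω ^ 2 := by
    rw [hZ]; nlinarith [sq_nonneg (‖x‖ ^ 2), mul_nonneg ha.le (sq_nonneg ‖x‖), sq_nonneg (a ω)]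
  calc ‖x‖ ^ 2 * ‖G m ω‖ ^ 2 = (‖x‖ ^ 2 * a ω) * (‖G m ω‖ ^ 2 / a ω) := by field_simp
    _ ≤ (2 * noiseEnergy a v ξ G m ω ^ 2) * (‖G m ω‖ ^ 2 / a ω) := by gcongr
    _ = _ := by ring

lemma pow_noiseEnergy_succ_le (h : IsNoiseData P 𝒢 τ K a v ξ G) (r m : ℕ) :
    ∀ᵐ ω ∂P, noiseEnergy a v ξ G (m + 1) ω ^ (r + 1) ≤ noiseEnergy a v ξ G m ω ^ (r + 1)
      + (r + 1) * (noiseEnergy a v ξ G m ω ^ r * drift v ξ G m ω) * ξ m ω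
      + stepConst r K * (‖G m ω‖ ^ 2 / a ω * noiseEnergy a v ξ G m ω ^ (r + 1))
        * momentWeight r (ξ m ω) := by
  filter_upwards [h.bound] with ω hω
  have ha : 0 < a ω := zero_lt_one.trans_le (h.one_le ω)
  have hZ := ha.trans_le (le_noiseEnergy a v ξ G m ω)
  rw [noiseEnergy_succ]
  refine pow_perturbation_le r (ξ m ω) hZ (by positivity) ?_ (h.sq_drift_le m ω) (by positivity) ?_
  · rw [div_le_iff₀ ha]
    exact (Finset.single_le_sum (f := fun k => ‖G k ω‖ ^ 2) (fun _ _ => sq_nonneg _)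
      (Finset.self_mem_range_succ m)).trans (hω (m + 1))
  · calc ‖G m ω‖ ^ 2 / 2 = ‖G m ω‖ ^ 2 / a ω / 2 * a ω := by field_simp
      _ ≤ _ := by
        gcongr
        exact le_noiseEnergy a v ξ G m ω

/-- The damped moments of the energy do not increase when one more mode of the noise is added. -/
lemma integrable_and_integral_damping_le [IsProbabilityMeasure P]
    (h : IsNoiseData P 𝒢 τ K a v ξ G) (hK : 0 ≤ K) {r : ℕ} {M : ℝ} (hM0 : 0 ≤ M)
    (hM : ∫ x, momentWeight r x ∂gaussianReal 0 τ ≤ M * τ)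
    (hint : Integrable (fun ω => noiseEnergy a v ξ G 0 ω ^ (r + 1)) P) (m : ℕ) :
    Integrable (fun ω => noiseEnergy a v ξ G m ω ^ (r + 1)) P ∧
      ∫ ω, damping (stepConst r K * (M * τ)) a G m ω * noiseEnergy a v ξ G m ω ^ (r + 1) ∂P ≤
        ∫ ω, noiseEnergy a v ξ G 0 ω ^ (r + 1) ∂P := by
  have hC := stepConst_nonneg r hK
  set c := stepConst r K * (M * τ) with hc
  have hc0 : 0 ≤ c := by positivity
  induction m with
  | zero => exact ⟨hint, by simp [damping]⟩
  | succ m ih =>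
    obtain ⟨ih1, ih2⟩ := ih
    set Z := noiseEnergy a v ξ G m with hZ
    have hZm := h.measurable_noiseEnergy m
    have hDm := h.measurable_drift m
    have hle := h.noisePast_le m
    have hle' : 𝒢 ≤ noisePast 𝒢 ξ m := le_sup_left
    have hψm := (h.measurable_damping c (m + 1)).mono hle' le_rfl
    have hαm : Measurable[noisePast 𝒢 ξ m] fun ω => ‖G m ω‖ ^ 2 / a ω :=
      (((h.measurable_G m).norm.measurable.pow_const 2).div h.measurable_a).mono hle' le_rfl
    have hZ1 : ∀ ω, 1 ≤ Z ω := fun ω => (h.one_le ω).trans (le_noiseEnergy a v ξ G m ω)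
    have hα0 : ∀ ω, 0 ≤ ‖G m ω‖ ^ 2 / a ω := fun ω =>
      div_nonneg (sq_nonneg _) (zero_le_one.trans (h.one_le ω))
    have hαK : ∀ᵐ ω ∂P, ‖G m ω‖ ^ 2 / a ω ≤ K := by
      filter_upwards [h.bound] with ω hω
      rw [div_le_iff₀ (zero_lt_one.trans_le (h.one_le ω))]
      exact (Finset.single_le_sum (f := fun k => ‖G k ω‖ ^ 2) (fun _ _ => sq_nonneg _)
        (Finset.self_mem_range_succ m)).trans (hω (m + 1))
    have hL : Integrable (fun ω => (r + 1) * (Z ω ^ r * drift v ξ G m ω)) P := by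
      refine Integrable.const_mul (Integrable.mono' (ih1.const_mul (1 + 2 * K))
        ((hZm.pow_const r).mul hDm |>.mono hle le_rfl).aestronglyMeasurable ?_) _
      filter_upwards [hαK] with ω hω
      have hD : |drift v ξ G m ω| ≤ (1 + 2 * K) * Z ω := by
        refine abs_le_of_sq_le_sq ?_ (mul_nonneg (by linarith) (zero_le_one.trans (hZ1 ω)))
        refine (h.sq_drift_le m ω).trans ?_
        rw [mul_pow]
        gcongr
        nlinarith
      rw [Pi.mul_apply, norm_mul, Real.norm_eq_abs, Real.norm_eq_abs, abs_of_nonneg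
        (pow_nonneg (zero_le_one.trans (hZ1 ω)) r)]
      calc Z ω ^ r * |drift v ξ G m ω| ≤ Z ω ^ r * ((1 + 2 * K) * Z ω) :=
            mul_le_mul_of_nonneg_left hD (pow_nonneg (zero_le_one.trans (hZ1 ω)) r)
        _ = _ := by ring
    have hB : Integrable (fun ω => stepConst r K * (‖G m ω‖ ^ 2 / a ω * Z ω ^ (r + 1))) P := by
      refine Integrable.const_mul (Integrable.mono' (ih1.const_mul K)
        (hαm.mul (hZm.pow_const (r + 1)) |>.mono hle le_rfl).aestronglyMeasurable ?_) _
      filter_upwards [hαK] with ω hω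
      have := pow_nonneg (zero_le_one.trans (hZ1 ω)) (r + 1)
      rw [Pi.mul_apply, Real.norm_of_nonneg (mul_nonneg (hα0 ω) this)]
      exact mul_le_mul_of_nonneg_right hω this
    have hψ : ∀ {X : Ω → ℝ}, Integrable X P →
        Integrable (fun ω => damping c a G (m + 1) ω * X ω) P := fun hX =>
      hX.bdd_mul (c := 1) (hψm.mono hle le_rfl).aestronglyMeasurable (ae_of_all _
        (h.norm_damping_le_one hc0 _))
    have hLm : Measurable[noisePast 𝒢 ξ m] fun ω => (r + 1) * (Z ω ^ r * drift v ξ G m ω) :=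
      ((hZm.pow_const r).mul hDm).const_mul _
    have hBm : Measurable[noisePast 𝒢 ξ m] fun ω =>
        stepConst r K * (‖G m ω‖ ^ 2 / a ω * Z ω ^ (r + 1)) :=
      (hαm.mul (hZm.pow_const (r + 1))).const_mul _
    have hξ := h.integrable_noise m
    have hw := h.integrable_momentWeight_noise r m
    have hwm := (measurable_momentWeight r).comp (h.measurable_ξ m)
    -- Independence gives integrability of the products without higher moments of `Z`, so the
    -- induction closes at the exponent `r + 1`.
    have hLξ := (h.indepFun hLm).integrable_mul hL hξ
    have hBξ := ((h.indepFun hBm).comp measurable_id (measurable_momentWeight r)).integrable_mul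
      hB hw
    have hup := (ih1.add hLξ).add hBξ
    have hstep := h.pow_noiseEnergy_succ_le r m
    have hint' : Integrable (fun ω => noiseEnergy a v ξ G (m + 1) ω ^ (r + 1)) P := by
      refine hup.mono' (((h.measurable_noiseEnergy (m + 1)).pow_const _).mono
        (h.noisePast_le _) le_rfl).aestronglyMeasurable ?_
      filter_upwards [hstep] with ω hω
      rw [Real.norm_of_nonneg (pow_nonneg (h.noiseEnergy_nonneg _ ω) _)]
      exact hω
    refine ⟨hint', ?_⟩
    -- The weight of index `m + 1` is already `𝒢`-measurable, so the whole coefficient is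
    -- independent of the centred `ξ m`.
    have hψL : ∫ ω, (damping c a G (m + 1) ω * ((r + 1) * (Z ω ^ r * drift v ξ G m ω))) * ξ m ω ∂P
        = 0 := by
      have := (h.indepFun (hψm.mul hLm)).integral_fun_mul_eq_mul_integral
        ((hψm.mul hLm).mono hle le_rfl).aestronglyMeasurable hξ.aestronglyMeasurable
      rwa [h.integral_noise, mul_zero] at this
    have hψB : ∫ ω, (damping c a G (m + 1) ω *
          (stepConst r K * (‖G m ω‖ ^ 2 / a ω * Z ω ^ (r + 1)))) * momentWeight r (ξ m ω) ∂P
        ≤ ∫ ω, damping c a G (m + 1) ω * (c * (‖G m ω‖ ^ 2 / a ω) * Z ω ^ (r + 1)) ∂P := by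
      have := ((h.indepFun (hψm.mul hBm)).comp measurable_id
        (measurable_momentWeight r)).integral_fun_mul_eq_mul_integral
        ((hψm.mul hBm).mono hle le_rfl).aestronglyMeasurable hwm.aestronglyMeasurable
      refine (le_of_eq this).trans ?_
      have e : (momentWeight r ∘ ξ m) = fun ω => momentWeight r (ξ m ω) := rfl
      rw [e, h.integral_momentWeight_noise]
      refine (mul_le_mul_of_nonneg_left hM (integral_nonneg fun ω => ?_)).trans (le_of_eq ?_)
      · exact mul_nonneg (Real.exp_nonneg _) (mul_nonneg hC (mul_nonneg (hα0 ω)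
          (pow_nonneg (zero_le_one.trans (hZ1 ω)) _)))
      · rw [mul_comm, ← integral_const_mul]
        refine integral_congr_ae (ae_of_all _ fun ω => ?_)
        simp only [id, Function.comp, Pi.mul_apply, hc]
        ring
    have hLψ : Integrable (fun ω => (damping c a G (m + 1) ω *
        ((r + 1) * (Z ω ^ r * drift v ξ G m ω))) * ξ m ω) P := by
      simpa only [mul_assoc, Pi.mul_apply] using hψ hLξ
    have hBψ : Integrable (fun ω => (damping c a G (m + 1) ω *
        (stepConst r K * (‖G m ω‖ ^ 2 / a ω * Z ω ^ (r + 1)))) * momentWeight r (ξ m ω)) P := by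
      simpa only [mul_assoc, Pi.mul_apply, Function.comp, id] using hψ hBξ
    have hcψ : Integrable (fun ω => damping c a G (m + 1) ω *
        (c * (‖G m ω‖ ^ 2 / a ω) * Z ω ^ (r + 1))) P := by
      have := (hψ hB).const_mul (M * τ)
      refine this.congr (ae_of_all _ fun ω => ?_)
      simp only [hc]
      ring
    calc ∫ ω, damping c a G (m + 1) ω * noiseEnergy a v ξ G (m + 1) ω ^ (r + 1) ∂P
        ≤ ∫ ω, (damping c a G (m + 1) ω * Z ω ^ (r + 1)
          + (damping c a G (m + 1) ω * ((r + 1) * (Z ω ^ r * drift v ξ G m ω))) * ξ m ω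
          + (damping c a G (m + 1) ω * (stepConst r K * (‖G m ω‖ ^ 2 / a ω * Z ω ^ (r + 1))))
            * momentWeight r (ξ m ω)) ∂P := by
          refine integral_mono_ae (hψ hint') (((hψ ih1).add hLψ).add hBψ) ?_
          filter_upwards [hstep] with ω hω
          have := mul_le_mul_of_nonneg_left hω (Real.exp_nonneg
            (-(c * ∑ k ∈ Finset.range (m + 1), ‖G k ω‖ ^ 2 / a ω)))
          refine this.trans (le_of_eq ?_)
          simp only [damping]
          ring
      _ = ∫ ω, damping c a G (m + 1) ω * Z ω ^ (r + 1) ∂P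
          + ∫ ω, (damping c a G (m + 1) ω * ((r + 1) * (Z ω ^ r * drift v ξ G m ω))) * ξ m ω ∂P
          + ∫ ω, (damping c a G (m + 1) ω * (stepConst r K * (‖G m ω‖ ^ 2 / a ω * Z ω ^ (r + 1))))
            * momentWeight r (ξ m ω) ∂P := by
          rw [integral_add (f := fun ω => damping c a G (m + 1) ω * Z ω ^ (r + 1)
            + (damping c a G (m + 1) ω * ((r + 1) * (Z ω ^ r * drift v ξ G m ω))) * ξ m ω)
            ((hψ ih1).add hLψ) hBψ, integral_add (hψ ih1) hLψ]
      _ ≤ ∫ ω, damping c a G (m + 1) ω * Z ω ^ (r + 1) ∂P + 0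
          + ∫ ω, damping c a G (m + 1) ω * (c * (‖G m ω‖ ^ 2 / a ω) * Z ω ^ (r + 1)) ∂P := by
          gcongr
          exact hψL.le
      _ = ∫ ω, damping c a G (m + 1) ω * (1 + c * (‖G m ω‖ ^ 2 / a ω)) * Z ω ^ (r + 1) ∂P := by
          rw [add_zero, ← integral_add (hψ ih1) hcψ]
          refine integral_congr_ae (ae_of_all _ fun ω => ?_)
          simp only
          ring
      _ ≤ ∫ ω, damping c a G m ω * Z ω ^ (r + 1) ∂P := by
          refine integral_mono_of_nonneg (ae_of_all _ fun ω => ?_) ?_ (ae_of_all _ fun ω => ?_)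
          · exact mul_nonneg (mul_nonneg (Real.exp_nonneg _) (add_nonneg zero_le_one
              (mul_nonneg hc0 (hα0 ω)))) (pow_nonneg (zero_le_one.trans (hZ1 ω)) _)
          · exact ih1.bdd_mul (c := 1) ((h.measurable_damping c m).mono h.le
              le_rfl).aestronglyMeasurable (ae_of_all _ (h.norm_damping_le_one hc0 _))
          · exact mul_le_mul_of_nonneg_right (damping_succ_mul_le m ω)
              (pow_nonneg (zero_le_one.trans (hZ1 ω)) _)
      _ ≤ _ := ih2

/-- The moments of the energy after the whole noise has been added. -/
lemma integrable_and_integral_le [IsProbabilityMeasure P]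
    (h : IsNoiseData P 𝒢 τ K a v ξ G) (hK : 0 ≤ K) {r : ℕ} {M : ℝ} (hM0 : 0 ≤ M)
    (hM : ∫ x, momentWeight r x ∂gaussianReal 0 τ ≤ M * τ)
    (hint : Integrable (fun ω => (a ω + 1 / 2 * ‖v ω‖ ^ 2) ^ (r + 1)) P) {Y : Ω → H}
    (hY : TendstoInMeasure P (fun m ω => ∑ k ∈ Finset.range m, ξ k ω • G k ω) atTop Y) :
    Integrable (fun ω => (a ω + 1 / 2 * ‖v ω + Y ω‖ ^ 2) ^ (r + 1)) P ∧
      ∫ ω, (a ω + 1 / 2 * ‖v ω + Y ω‖ ^ 2) ^ (r + 1) ∂P ≤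
        Real.exp (stepConst r K * M * K * τ) *
          ∫ ω, (a ω + 1 / 2 * ‖v ω‖ ^ 2) ^ (r + 1) ∂P := by
  have hC := stepConst_nonneg r hK
  have hc0 : 0 ≤ stepConst r K * (M * τ) := by positivity
  have hint' : Integrable (fun ω => noiseEnergy a v ξ G 0 ω ^ (r + 1)) P := by
    simpa [noiseEnergy] using hint
  -- Convergence in probability suffices: Fatou is applied along an almost surely convergent
  -- subsequence, with bounds uniform in the number of modes.
  obtain ⟨ns, -, hns⟩ := hY.exists_seq_tendsto_ae
  refine integrable_and_integral_le_of_tendsto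
    (F := fun n ω => noiseEnergy a v ξ G (ns n) ω ^ (r + 1))
    (fun n => (h.integrable_and_integral_damping_le hK hM0 hM hint' (ns n)).1)
    (fun n ω => pow_nonneg (h.noiseEnergy_nonneg _ ω) _) (fun n => ?_) ?_
  · obtain ⟨h1, h2⟩ := h.integrable_and_integral_damping_le hK hM0 hM hint' (ns n)
    have h3 : Real.exp (-(stepConst r K * (M * τ) * K)) *
        ∫ ω, noiseEnergy a v ξ G (ns n) ω ^ (r + 1) ∂P ≤
        ∫ ω, noiseEnergy a v ξ G 0 ω ^ (r + 1) ∂P := by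
      refine le_trans ?_ h2
      rw [← integral_const_mul]
      refine integral_mono_ae (h1.const_mul _) (h1.bdd_mul (c := 1)
        ((h.measurable_damping _ _).mono h.le le_rfl).aestronglyMeasurable
        (ae_of_all _ (h.norm_damping_le_one hc0 _))) ?_
      filter_upwards [h.le_damping hc0 (ns n)] with ω hω
      exact mul_le_mul_of_nonneg_right hω (pow_nonneg (h.noiseEnergy_nonneg _ ω) _)
    rw [Real.exp_neg, inv_mul_le_iff₀ (Real.exp_pos _)] at h3
    have e₀ : ∀ ω, noiseEnergy a v ξ G 0 ω = a ω + 1 / 2 * ‖v ω‖ ^ 2 := fun ω => by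
      simp [noiseEnergy]
    have e₁ : stepConst r K * (M * τ) * K = stepConst r K * M * K * τ := by ring
    simp only [e₀] at h3
    rwa [e₁] at h3
  · filter_upwards [hns] with ω hω
    exact (((hω.const_add (v ω)).norm.pow 2).const_mul (1 / 2) |>.const_add (a ω)).pow (r + 1)

end IsNoiseData

end NoiseMoments

end SAV

namespace SAV

/-! ### Polynomial growth of the potential and of the initial energy -/

section InitialEnergy

variable {d : ℕ} {O : Set (EuclideanSpace ℝ (Fin d))} {S : DirichletEigenpairs O}

lemma exists_eval_le (b : Polynomial ℝ) :
    ∃ B : ℝ, 0 ≤ B ∧ ∀ t, 0 ≤ t → b.eval t ≤ B * (1 + t) ^ b.natDegree := by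
  refine ⟨∑ i ∈ Finset.range (b.natDegree + 1), |b.coeff i|,
    Finset.sum_nonneg fun _ _ => abs_nonneg _, fun t ht => ?_⟩
  rw [Polynomial.eval_eq_sum_range, Finset.sum_mul]
  refine Finset.sum_le_sum fun i hi => ?_
  have h1 : t ^ i ≤ (1 + t) ^ b.natDegree :=
    (pow_le_pow_left₀ ht (by linarith) i).trans
      (pow_le_pow_right₀ (by linarith) (Nat.lt_succ_iff.1 (Finset.mem_range.1 hi)))
  exact mul_le_mul (le_abs_self _) h1 (by positivity) (abs_nonneg _)

namespace DirichletEigenpairs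

lemma MemH1.smul {u : L2 O} (hu : S.MemH1 u) (s : ℝ) : S.MemH1 (s • u) := by
  refine (Summable.mul_left (s ^ 2) hu).congr fun i => ?_
  rw [real_inner_smul_right]
  ring

lemma normH1_smul (u : L2 O) {s : ℝ} (hs : 0 ≤ s) : S.normH1 (s • u) = s * S.normH1 u := by
  have h : ∀ i, S.eig i * ⟪S.e i, s • u⟫ ^ 2 = s ^ 2 * (S.eig i * ⟪S.e i, u⟫ ^ 2) := fun i => by
    rw [real_inner_smul_right]; ring
  rw [normH1, normH1, tsum_congr h, tsum_mul_left, Real.sqrt_mul (sq_nonneg s), Real.sqrt_sq hs]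

lemma MemH1.norm_le {u : L2 O} (hu : S.MemH1 u) : ‖u‖ ≤ (√(S.eig 0))⁻¹ * S.normH1 u := by
  have h0 := S.eig_pos 0
  have h1 : S.eig 0 * ‖u‖ ^ 2 ≤ S.normH1 u ^ 2 :=
    hasSum_le (fun i => mul_le_mul_of_nonneg_right (S.eig_mono (Nat.zero_le i)) (sq_nonneg _))
      ((S.hasSum_coord_sq u).mul_left (S.eig 0)) hu.hasSum
  rw [le_inv_mul_iff₀ (Real.sqrt_pos.2 h0)]
  refine (sq_le_sq₀ (by positivity) (S.normH1_nonneg u)).1 ?_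
  rwa [mul_pow, Real.sq_sqrt h0.le]

lemma memH1_zero : S.MemH1 0 := by
  simp [MemH1, summable_zero]

end DirichletEigenpairs

lemma eLpNorm_nemytskii {f : ℝ → ℝ} {w : L2 O}
    (h : MemLp (fun x => f (w x)) 2 (volume.restrict O)) :
    eLpNorm (fun x => f (w x)) 2 (volume.restrict O) = ENNReal.ofReal ‖nemytskii f w‖ := by
  rw [nemytskii, dif_pos h, Lp.norm_toLp, ENNReal.ofReal_toReal h.2.ne]

/-- The fundamental theorem of calculus along `s ↦ s y`. As a mere derivative, `f` may fail to be
integrable on the segment; the right-hand side is then infinite. -/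
lemma enorm_sub_le_lintegral {f Ft : ℝ → ℝ} (hf : ∀ x, HasDerivAt Ft (f x) x) (hfm : Measurable f)
    (y : ℝ) : ‖Ft y - Ft 0‖ₑ ≤ ∫⁻ s in Set.Ioc (0 : ℝ) 1, ‖f (s * y) * y‖ₑ := by
  by_cases h : ∫⁻ s in Set.Ioc (0 : ℝ) 1, ‖f (s * y) * y‖ₑ = ⊤
  · rw [h]; exact le_top
  have hm : Measurable fun s => f (s * y) * y := by fun_prop
  have hint : IntegrableOn (fun s => f (s * y) * y) (Set.Ioc 0 1) :=
    ⟨hm.aestronglyMeasurable, lt_top_iff_ne_top.2 h⟩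
  have hder : ∀ s ∈ Set.uIcc (0 : ℝ) 1,
      HasDerivAt (fun s => Ft (s * y)) (f (s * y) * y) s := fun s _ =>
    (hf (s * y)).comp s (hasDerivAt_mul_const y)
  have hftc := intervalIntegral.integral_eq_sub_of_hasDerivAt hder
    ((intervalIntegrable_iff_integrableOn_Ioc_of_le zero_le_one).2 hint)
  rw [one_mul, zero_mul, intervalIntegral.integral_of_le zero_le_one] at hftc
  rw [← hftc]
  exact enorm_integral_le_lintegral_enorm _

namespace CoefficientAssumption

variable {R : L2 O →L[ℝ] L2 O} {k : ℕ} {δ₀ : ℝ} {f Ft : ℝ → ℝ}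
  {g : L2 O × (Fin d → L2 O) → NoiseOp R}

lemma measurable_force (h : CoefficientAssumption S k δ₀ f Ft g) : Measurable f := by
  have : f = _root_.deriv Ft := funext fun x => (h.deriv x).deriv.symm
  rw [this]
  exact measurable_deriv Ft

lemma lintegral_force_mul_le (h : CoefficientAssumption S k δ₀ f Ft g) {u : L2 O}
    (hu : S.MemH1 u) (s : ℝ) :
    ∫⁻ x in O, ‖f (s * u x) * u x‖ₑ ≤ ENNReal.ofReal (‖nemytskii f (s • u)‖ * ‖u‖) := by
  have hfm := h.measurable_force
  have hum : Measurable u := (Lp.stronglyMeasurable u).measurable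
  have hsu : (fun x => f ((s • u : L2 O) x)) =ᵐ[volume.restrict O] fun x => f (s * u x) := by
    filter_upwards [Lp.coeFn_smul s u] with x hx
    rw [hx, Pi.smul_apply, smul_eq_mul]
  have h1 : eLpNorm ((fun x => f (s * u x)) • (u : EuclideanSpace ℝ (Fin d) → ℝ)) 1
      (volume.restrict O) ≤ eLpNorm (fun x => f (s * u x)) 2 (volume.restrict O) *
        eLpNorm u 2 (volume.restrict O) :=
    eLpNorm_smul_le_mul_eLpNorm hum.aestronglyMeasurable
      (hfm.comp (hum.const_mul s)).aestronglyMeasurable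
  rw [eLpNorm_one_eq_lintegral_enorm, ← eLpNorm_congr_ae hsu,
    eLpNorm_nemytskii (h.f_memLp _ (hu.smul s))] at h1
  rw [ENNReal.ofReal_mul (norm_nonneg _), Lp.norm_def u,
    ENNReal.ofReal_toReal (Lp.eLpNorm_ne_top u)]
  exact h1

/-- Integrate the derivative along the segment from `0` to `u`, exchange the integrals by Tonelli,
and use Cauchy–Schwarz in space for each `s`. -/
lemma abs_potential_sub_le (h : CoefficientAssumption S k δ₀ f Ft g) {u : L2 O}
    (hu : S.MemH1 u) {B : ℝ} (hB : ∀ s ∈ Set.Ioc (0 : ℝ) 1, ‖nemytskii f (s • u)‖ ≤ B) :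
    |potential Ft u - potential Ft (0 : L2 O)| ≤ B * ‖u‖ := by
  have hfm := h.measurable_force
  have hum : Measurable u := (Lp.stronglyMeasurable u).measurable
  have hB0 : 0 ≤ B := (norm_nonneg _).trans (hB 1 ⟨zero_lt_one, le_rfl⟩)
  have hkey : ∫⁻ x in O, ‖Ft (u x) - Ft ((0 : L2 O) x)‖ₑ ≤ ENNReal.ofReal (B * ‖u‖) := by
    calc ∫⁻ x in O, ‖Ft (u x) - Ft ((0 : L2 O) x)‖ₑ
        = ∫⁻ x in O, ‖Ft (u x) - Ft 0‖ₑ := by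
          refine lintegral_congr_ae ?_
          filter_upwards [Lp.coeFn_zero ℝ 2 (volume.restrict O)] with x hx
          rw [hx, Pi.zero_apply]
      _ ≤ ∫⁻ x in O, ∫⁻ s in Set.Ioc (0 : ℝ) 1, ‖f (s * u x) * u x‖ₑ :=
          lintegral_mono fun x => enorm_sub_le_lintegral h.deriv hfm (u x)
      _ = ∫⁻ s in Set.Ioc (0 : ℝ) 1, ∫⁻ x in O, ‖f (s * u x) * u x‖ₑ := by
          refine lintegral_lintegral_swap ?_
          have : Measurable fun z : EuclideanSpace ℝ (Fin d) × ℝ => f (z.2 * u z.1) * u z.1 :=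
            (hfm.comp (measurable_snd.mul (hum.comp measurable_fst))).mul (hum.comp measurable_fst)
          exact this.enorm.aemeasurable
      _ ≤ ∫⁻ _ in Set.Ioc (0 : ℝ) 1, ENNReal.ofReal (B * ‖u‖) := by
          refine setLIntegral_mono measurable_const fun s hs => ?_
          exact (h.lintegral_force_mul_le hu s).trans (ENNReal.ofReal_le_ofReal
            (mul_le_mul_of_nonneg_right (hB s hs) (norm_nonneg u)))
      _ = ENNReal.ofReal (B * ‖u‖) := by simp
  rw [potential, potential, ← integral_sub (h.F_integrable u hu)
    (h.F_integrable 0 DirichletEigenpairs.memH1_zero), ← Real.norm_eq_abs, ← toReal_enorm]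
  exact ENNReal.toReal_le_of_le_ofReal (by positivity)
    ((enorm_integral_le_lintegral_enorm _).trans hkey)

/-- The assumptions bound `F` only from below; the upper bound comes from the growth of `f`. The
degree is immaterial, as all moments of `X₀` are finite. -/
lemma exists_potential_le (h : CoefficientAssumption S k δ₀ f Ft g) :
    ∃ (C : ℝ) (n : ℕ), 0 ≤ C ∧ ∀ u, S.MemH1 u →
      potential Ft u + δ₀ ≤ C * (1 + S.normH1 u) ^ n := by
  obtain ⟨b, -, hb⟩ := h.f_growth
  obtain ⟨B, hB0, hB⟩ := exists_eval_le b
  have hδ := h.δ₀_pos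
  refine ⟨|potential Ft (0 : L2 O)| + δ₀ + B * (√(S.eig 0))⁻¹, b.natDegree + 1, by positivity,
    fun u hu => ?_⟩
  have hn := S.normH1_nonneg u
  have h1 := h.abs_potential_sub_le hu (B := B * (1 + S.normH1 u) ^ b.natDegree) fun s hs => by
    refine (hb _ (hu.smul s)).trans ?_
    rw [DirichletEigenpairs.normH1_smul u hs.1.le]
    refine (hB _ (mul_nonneg hs.1.le hn)).trans ?_
    have : s * S.normH1 u ≤ S.normH1 u := mul_le_of_le_one_left hn hs.2
    have := mul_nonneg hs.1.le hn
    gcongr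
  have h2 : B * (1 + S.normH1 u) ^ b.natDegree * ‖u‖ ≤
      B * (√(S.eig 0))⁻¹ * (1 + S.normH1 u) ^ (b.natDegree + 1) := by
    calc B * (1 + S.normH1 u) ^ b.natDegree * ‖u‖
        ≤ B * (1 + S.normH1 u) ^ b.natDegree * ((√(S.eig 0))⁻¹ * (1 + S.normH1 u)) := by
          gcongr
          exact hu.norm_le.trans (by gcongr; linarith)
      _ = _ := by ring
  have h3 : (1 : ℝ) ≤ (1 + S.normH1 u) ^ (b.natDegree + 1) := one_le_pow₀ (by linarith)
  have h4 := le_abs_self (potential Ft u - potential Ft (0 : L2 O))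
  have h5 := le_abs_self (potential Ft (0 : L2 O))
  have h6 : |potential Ft (0 : L2 O)| + δ₀ ≤
      (|potential Ft (0 : L2 O)| + δ₀) * (1 + S.normH1 u) ^ (b.natDegree + 1) :=
    le_mul_of_one_le_right (by positivity) h3
  rw [add_mul]
  linarith

lemma exists_initial_energy_le (h : CoefficientAssumption S k δ₀ f Ft g) :
    ∃ (C : ℝ) (n : ℕ), 0 ≤ C ∧ ∀ u v, S.MemH1 u →
      1 + energy S u v √(potential Ft u + δ₀) ≤ C * (1 + S.normProd u v) ^ n := by
  obtain ⟨C, n, hC, hn⟩ := h.exists_potential_le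
  obtain ⟨c, hc, hlow⟩ := h.lower
  refine ⟨2 + C, n + 2, by positivity, fun u v hu => ?_⟩
  have hρ : 0 ≤ S.normProd u v := Real.sqrt_nonneg _
  have hρ2 : S.normProd u v ^ 2 = S.normH1 u ^ 2 + ‖v‖ ^ 2 := Real.sq_sqrt (by positivity)
  have hle : S.normH1 u ≤ S.normProd u v := Real.le_sqrt_of_sq_le (by nlinarith [sq_nonneg ‖v‖])
  have h0 := S.normH1_nonneg u
  -- The lower bound on `F + δ₀` ensures that `q₀²` really is `F(u₀) + δ₀`.
  rw [energy, Real.sq_sqrt (hc.le.trans (hlow u hu))]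
  set ρ := S.normProd u v
  have h1 : (1 + ρ) ^ 2 ≤ (1 + ρ) ^ (n + 2) := pow_le_pow_right₀ (by linarith) (by omega)
  have h2 : C * (1 + S.normH1 u) ^ n ≤ C * (1 + ρ) ^ (n + 2) := by
    refine mul_le_mul_of_nonneg_left ?_ hC
    exact (pow_le_pow_left₀ (by linarith) (by linarith) n).trans
      (pow_le_pow_right₀ (by linarith) (by omega))
  have h3 := hn u hu
  rw [add_mul]
  nlinarith

end CoefficientAssumption

end InitialEnergy

end SAV

namespace SAV

/-! ### Propagation of the moments along the numerical solution -/

section Moments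

variable {d : ℕ} {O : Set (EuclideanSpace ℝ (Fin d))} {S : DirichletEigenpairs O}
  {R : L2 O →L[ℝ] L2 O} {k : ℕ} {δ₀ : ℝ} {f Ft : ℝ → ℝ}
  {g : L2 O × (Fin d → L2 O) → NoiseOp R} {Ω : Type*} {m : MeasurableSpace Ω} {P : Measure Ω}
  {ℱ : Filtration ℝ≥0 m} {β : ℕ → ℝ≥0 → Ω → ℝ} {u₀ v₀ : Ω → L2 O} {scheme : Scheme}
  {π : Predictor} {τ : ℝ≥0} {N : ℕ} {u v : ℕ → Ω → L2 O} {q : ℕ → Ω → ℝ}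

lemma energy_nonneg (S : DirichletEigenpairs O) (u v : L2 O) (q : ℝ) : 0 ≤ energy S u v q := by
  unfold energy; positivity

/-- The modified energy after a step of either scheme is that of the state whose velocity has been
perturbed by the noise. -/
lemma IsNumericalSolution.energy_step
    (h : IsNumericalSolution S δ₀ f Ft g P ℱ β u₀ v₀ scheme π τ N u v q) (hτ : 0 < τ) {n : ℕ}
    (hn : n < N) : ∃ Y : Ω → L2 O,
      IsNoiseIncrement S P β (n * τ) ((n + 1) * τ) (fun ω => g (Theta (u n ω))) Y ∧
      ∀ᵐ ω ∂P, energy S (u (n + 1) ω) (v (n + 1) ω) (q (n + 1) ω) =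
        energy S (u n ω) (v n ω + Y ω) (q n ω) := by
  obtain ⟨Y, hY, hstep⟩ := h.step n hn
  refine ⟨Y, hY, ?_⟩
  filter_upwards [hstep, h.memH1 n hn.le, h.memH1 (n + 1) hn] with ω hω hu hu'
  cases scheme with
  | midpoint => exact MidpointStep.energy_eq (NNReal.coe_pos.2 hτ) hu hu' hω
  | exponential => exact ExponentialStep.energy_eq hu hu' hω

lemma IsBrownianSequence.isNoiseData [IsProbabilityMeasure P] (hβ : IsBrownianSequence P ℱ β)
    {s t : ℝ≥0} (hst : s ≤ t) (ht : t = s + τ) {K : ℝ} {a : Ω → ℝ} {w : Ω → L2 O}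
    {G : ℕ → Ω → L2 O} (ha : Measurable[ℱ s] a) (hw : StronglyMeasurable[ℱ s] w)
    (hG : ∀ j, StronglyMeasurable[ℱ s] (G j)) (h1 : ∀ ω, 1 ≤ a ω)
    (hb : ∀ᵐ ω ∂P, ∀ l, ∑ j ∈ Finset.range l, ‖G j ω‖ ^ 2 ≤ K * a ω) :
    IsNoiseData P (ℱ s) τ K a w (fun j ω => β j t ω - β j s ω) G where
  le := ℱ.le s
  measurable_ξ j := ((hβ.adapted j t).mono (ℱ.le t) le_rfl).sub
    ((hβ.adapted j s).mono (ℱ.le s) le_rfl)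
  law j := by
    have h := (hβ.brownian j).toIsPreBrownianReal.hasLaw_sub t s
    have e : nndist t.1 s.1 = τ := by
      ext
      rw [coe_nndist, Real.dist_eq, ht]
      simp
    rwa [e] at h
  indep := hβ.indep.comp (fun _ x => x t - x s) fun _ =>
    (measurable_pi_apply t).sub (measurable_pi_apply s)
  indep_past := hβ.indep_past s t hst
  measurable_a := ha
  measurable_v := hw
  measurable_G := hG
  one_le := h1
  bound := hb

lemma IsNumericalSolution.measurable_energy
    (h : IsNumericalSolution S δ₀ f Ft g P ℱ β u₀ v₀ scheme π τ N u v q) {n : ℕ} (hn : n ≤ N) :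
    Measurable fun ω => energy S (u n ω) (v n ω) (q n ω) := by
  have hle := ℱ.le (n * τ)
  have h1 := S.measurable_normH1 ((h.u_adapted n hn).mono hle)
  have h2 := ((h.v_adapted n hn).mono hle).norm.measurable
  have h3 := ((h.q_adapted n hn).mono hle).measurable
  unfold energy
  fun_prop

/-- The additional linear growth of `g` enters here, through `(1 + h)² ≤ 4 (1 + ½ h²)`; this fixes
`K = 4 c₂²`. -/
lemma sum_norm_at_sq_le (hfg : CoefficientAssumption S k δ₀ f Ft g) {c₂ : ℝ}
    (hg : ∀ u, S.MemH1 u → (g (Theta u)).hsNorm S ≤ c₂ * (1 + S.normH1 u)) {w : L2 O}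
    (hw : S.MemH1 w) (l : ℕ) {x : ℝ} (hx : 1 + 1 / 2 * S.normH1 w ^ 2 ≤ x) :
    ∑ j ∈ Finset.range l, ‖(g (Theta w)).at_ (S.e j)‖ ^ 2 ≤ 4 * c₂ ^ 2 * x := by
  have h0 := S.normH1_nonneg w
  calc ∑ j ∈ Finset.range l, ‖(g (Theta w)).at_ (S.e j)‖ ^ 2
      ≤ (g (Theta w)).hsNorm S ^ 2 := (hfg.g_hs w hw).sum_le S _
    _ ≤ (c₂ * (1 + S.normH1 w)) ^ 2 :=
        pow_le_pow_left₀ (NoiseOp.hsNorm_nonneg S _) (hg w hw) 2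
    _ = c₂ ^ 2 * (1 + S.normH1 w) ^ 2 := mul_pow _ _ _
    _ ≤ c₂ ^ 2 * (4 * x) := by
        gcongr
        nlinarith [sq_nonneg (S.normH1 w - 1)]
    _ = _ := by ring

/-- One step of either scheme multiplies the moments of `1 + V` by at most `exp(C τ)`. -/
lemma IsNumericalSolution.moment_step [IsProbabilityMeasure P]
    (h : IsNumericalSolution S δ₀ f Ft g P ℱ β u₀ v₀ scheme π τ N u v q)
    (hfg : CoefficientAssumption S k δ₀ f Ft g) {c₂ : ℝ}
    (hg : ∀ u, S.MemH1 u → (g (Theta u)).hsNorm S ≤ c₂ * (1 + S.normH1 u))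
    (hβ : IsBrownianSequence P ℱ β) (hτ : 0 < τ) {r : ℕ} {M : ℝ} (hM0 : 0 ≤ M)
    (hM : ∫ x, momentWeight r x ∂gaussianReal 0 τ ≤ M * τ) {n : ℕ} (hn : n < N)
    (hint : Integrable (fun ω => (1 + energy S (u n ω) (v n ω) (q n ω)) ^ (r + 1)) P) :
    Integrable
        (fun ω => (1 + energy S (u (n + 1) ω) (v (n + 1) ω) (q (n + 1) ω)) ^ (r + 1)) P ∧
      ∫ ω, (1 + energy S (u (n + 1) ω) (v (n + 1) ω) (q (n + 1) ω)) ^ (r + 1) ∂P ≤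
        Real.exp (stepConst r (4 * c₂ ^ 2) * M * (4 * c₂ ^ 2) * τ) *
          ∫ ω, (1 + energy S (u n ω) (v n ω) (q n ω)) ^ (r + 1) ∂P := by
  obtain ⟨Y, hY, hE⟩ := h.energy_step hτ hn
  choose G hGm hG using fun j => hfg.exists_measurable_at (h.u_adapted n hn.le) j
  -- All of `1 + V` except the kinetic term; the summand `1` gives `a ≥ 1` and absorbs the constant
  -- in the growth of `g`.
  set a : Ω → ℝ := fun ω => 1 + 1 / 2 * S.normH1 (u n ω) ^ 2 + q n ω ^ 2 with ha
  have he : ∀ ω (x : L2 O), 1 + energy S (u n ω) x (q n ω) = a ω + 1 / 2 * ‖x‖ ^ 2 :=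
    fun ω x => by simp only [energy, ha]; ring
  have ham : Measurable[ℱ (n * τ)] a :=
    ((((S.measurable_normH1 (h.u_adapted n hn.le)).pow_const 2).const_mul _).const_add 1).add
      ((h.q_adapted n hn.le).measurable.pow_const 2)
  have hdata : IsNoiseData P (ℱ (n * τ)) τ (4 * c₂ ^ 2) a (v n)
      (fun j ω => β j ((n + 1) * τ) ω - β j (n * τ) ω) G := by
    refine hβ.isNoiseData (by gcongr; exact le_self_add) (by ring) ham (h.v_adapted n hn.le) hGm
      (fun ω => ?_) ?_
    · have := sq_nonneg (S.normH1 (u n ω))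
      have := sq_nonneg (q n ω)
      simp only [ha]; linarith
    · filter_upwards [h.memH1 n hn.le] with ω hω l
      simp only [hG _ ω hω]
      exact sum_norm_at_sq_le hfg hg hω l (le_add_of_nonneg_right (sq_nonneg _))
  have hY' : TendstoInMeasure P (fun l ω => ∑ j ∈ Finset.range l,
      (β j ((n + 1) * τ) ω - β j (n * τ) ω) • G j ω) atTop Y := by
    refine TendstoInMeasure.congr_left (fun l => ?_) hY
    filter_upwards [h.memH1 n hn.le] with ω hω
    simp only [hG _ ω hω]
  have hEq : (fun ω => (1 + energy S (u (n + 1) ω) (v (n + 1) ω) (q (n + 1) ω)) ^ (r + 1))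
      =ᵐ[P] fun ω => (a ω + 1 / 2 * ‖v n ω + Y ω‖ ^ 2) ^ (r + 1) := by
    filter_upwards [hE] with ω hω
    rw [hω, he]
  simp only [he] at hint ⊢
  obtain ⟨h1, h2⟩ := hdata.integrable_and_integral_le (by positivity) hM0 hM hint hY'
  exact ⟨h1.congr hEq.symm, (integral_congr_ae hEq).le.trans h2⟩

/-- The moments of `1 + V` stay bounded on `[0, T]`. -/
lemma IsNumericalSolution.moment_le [IsProbabilityMeasure P]
    (h : IsNumericalSolution S δ₀ f Ft g P ℱ β u₀ v₀ scheme π τ N u v q)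
    (hfg : CoefficientAssumption S k δ₀ f Ft g) {c₂ : ℝ}
    (hg : ∀ u, S.MemH1 u → (g (Theta u)).hsNorm S ≤ c₂ * (1 + S.normH1 u))
    (hβ : IsBrownianSequence P ℱ β) (hτ : 0 < τ) {r : ℕ} {M I₀ : ℝ} (hM0 : 0 ≤ M)
    (hM : ∫ x, momentWeight r x ∂gaussianReal 0 τ ≤ M * τ)
    (hint : Integrable (fun ω => (1 + energy S (u 0 ω) (v 0 ω) (q 0 ω)) ^ (r + 1)) P)
    (hI₀ : ∫ ω, (1 + energy S (u 0 ω) (v 0 ω) (q 0 ω)) ^ (r + 1) ∂P ≤ I₀) (n : ℕ) (hn : n ≤ N) :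
    Integrable (fun ω => (1 + energy S (u n ω) (v n ω) (q n ω)) ^ (r + 1)) P ∧
      ∫ ω, (1 + energy S (u n ω) (v n ω) (q n ω)) ^ (r + 1) ∂P ≤
        Real.exp (stepConst r (4 * c₂ ^ 2) * M * (4 * c₂ ^ 2) * (n * τ)) * I₀ := by
  induction n with
  | zero => exact ⟨hint, by simpa using hI₀⟩
  | succ n ih =>
    obtain ⟨ih1, ih2⟩ := ih (Nat.le_of_succ_le hn)
    obtain ⟨h1, h2⟩ := h.moment_step hfg hg hβ hτ hM0 hM hn ih1
    refine ⟨h1, h2.trans ((mul_le_mul_of_nonneg_left ih2 (Real.exp_nonneg _)).trans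
      (le_of_eq ?_))⟩
    rw [← mul_assoc, ← Real.exp_add]
    push_cast
    ring_nf

lemma integrable_one_add_pow [IsProbabilityMeasure P] {ρ : Ω → ℝ} (h0 : ∀ ω, 0 ≤ ρ ω)
    (h : ∀ r : ℕ, Integrable (fun ω => ρ ω ^ r) P) (n : ℕ) :
    Integrable (fun ω => (1 + ρ ω) ^ n) P := by
  have hm : AEStronglyMeasurable ρ P := by simpa using (h 1).aestronglyMeasurable
  refine Integrable.mono' (((integrable_const 1).add (h n)).const_mul (2 ^ (n - 1)))
    ((aestronglyMeasurable_const.add hm).pow n) (ae_of_all _ fun ω => ?_)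
  have := h0 ω
  rw [Real.norm_of_nonneg (by positivity)]
  simpa using add_pow_le zero_le_one this n

/-- The bound involves only `X₀`, so it is the same for all step sizes and both schemes. -/
lemma IsNumericalSolution.initial_moment_le
    (h : IsNumericalSolution S δ₀ f Ft g P ℱ β u₀ v₀ scheme π τ N u v q) {C : ℝ} {j : ℕ}
    (hC : ∀ u v, S.MemH1 u → 1 + energy S u v √(potential Ft u + δ₀) ≤
      C * (1 + S.normProd u v) ^ j) (hX₀ : ∀ᵐ ω ∂P, S.MemH1 (u₀ ω)) (r : ℕ)
    (hint : Integrable (fun ω => (C * (1 + S.normProd (u₀ ω) (v₀ ω)) ^ j) ^ (r + 1)) P) :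
    Integrable (fun ω => (1 + energy S (u 0 ω) (v 0 ω) (q 0 ω)) ^ (r + 1)) P ∧
      ∫ ω, (1 + energy S (u 0 ω) (v 0 ω) (q 0 ω)) ^ (r + 1) ∂P ≤
        ∫ ω, (C * (1 + S.normProd (u₀ ω) (v₀ ω)) ^ j) ^ (r + 1) ∂P := by
  have hpos : ∀ ω, 0 ≤ 1 + energy S (u 0 ω) (v 0 ω) (q 0 ω) := fun ω =>
    add_nonneg zero_le_one (energy_nonneg S _ _ _)
  have hle : ∀ᵐ ω ∂P, (1 + energy S (u 0 ω) (v 0 ω) (q 0 ω)) ^ (r + 1) ≤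
      (C * (1 + S.normProd (u₀ ω) (v₀ ω)) ^ j) ^ (r + 1) := by
    filter_upwards [h.init_u, h.init_v, h.init_q, hX₀] with ω hu hv hq hω
    refine pow_le_pow_left₀ (hpos ω) ?_ _
    rw [hu, hv, hq]
    exact hC _ _ hω
  have hi : Integrable (fun ω => (1 + energy S (u 0 ω) (v 0 ω) (q 0 ω)) ^ (r + 1)) P := by
    refine hint.mono' (((h.measurable_energy (Nat.zero_le N)).const_add 1).pow_const
      (r + 1)).aestronglyMeasurable ?_
    filter_upwards [hle] with ω hω
    rwa [Real.norm_of_nonneg (pow_nonneg (hpos ω) _)]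
  exact ⟨hi, integral_mono_ae hi hint hle⟩

/-- Reduces a real exponent to a natural one of the form `r + 1`; the base `1 + x ≥ 1` allows the
exponent to be raised. -/
lemma rpow_le_one_add_pow_ceil {x p : ℝ} (hx : 0 ≤ x) (hp : 0 ≤ p) :
    x ^ p ≤ (1 + x) ^ (⌈p⌉₊ + 1) := by
  calc x ^ p ≤ (1 + x) ^ p := Real.rpow_le_rpow hx (by linarith) hp
    _ ≤ (1 + x) ^ ((⌈p⌉₊ + 1 : ℕ) : ℝ) := by
      refine Real.rpow_le_rpow_of_exponent_le (by linarith) ?_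
      push_cast
      linarith [Nat.le_ceil p]
    _ = _ := Real.rpow_natCast _ _

end Moments

end SAV

/-! ### Uniform moment bound for both schemes -/

theorem corollary3p1 {d : ℕ} (hd₁ : 1 ≤ d) (hd₃ : d ≤ 3) {O : Set (EuclideanSpace ℝ (Fin d))}
    (hO : SAV.IsConvexPolygonalDomain O) (S : SAV.DirichletEigenpairs O)
    (Q R : SAV.L2 O →L[ℝ] SAV.L2 O) (hQ : SAV.IsCovariance S Q R)
    (k : ℕ) (δ₀ : ℝ) (f Ft : ℝ → ℝ) (g : SAV.L2 O × (Fin d → SAV.L2 O) → SAV.NoiseOp R)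
    (hfg : SAV.CoefficientAssumption S k δ₀ f Ft g)
    (c₂ : ℝ) (hc₂ : 0 < c₂)
    (hg : ∀ u, S.MemH1 u → (g (SAV.Theta u)).hsNorm S ≤ c₂ * (1 + S.normH1 u))
    {Ω : Type*} [m : MeasurableSpace Ω] (P : Measure Ω) [IsProbabilityMeasure P]
    (ℱ : Filtration ℝ≥0 m)
    (u₀ v₀ : Ω → SAV.L2 O)
    (hu₀ : StronglyMeasurable[ℱ 0] u₀) (hv₀ : StronglyMeasurable[ℱ 0] v₀)
    (hX₀ : ∀ᵐ ω ∂P, S.MemH1 (u₀ ω))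
    (hmom : ∀ r : ℕ, Integrable (fun ω => S.normProd (u₀ ω) (v₀ ω) ^ r) P)
    (T : ℝ≥0) (hT : 0 < T) (p : ℝ) (hp : 1 ≤ p) :
    ∃ C : ℝ, 0 < C ∧
      ∀ β : ℕ → ℝ≥0 → Ω → ℝ, SAV.IsBrownianSequence P ℱ β →
      ∀ (scheme : SAV.Scheme) (π : SAV.Predictor) (N : ℕ), 1 ≤ N →
      ∀ (u v : ℕ → Ω → SAV.L2 O) (q : ℕ → Ω → ℝ),
        SAV.IsNumericalSolution S δ₀ f Ft g P ℱ β u₀ v₀ scheme π (T / N) N u v q →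
        ∀ n ≤ N, Integrable (fun ω => SAV.energy S (u n ω) (v n ω) (q n ω) ^ p) P ∧
          ∫ ω, SAV.energy S (u n ω) (v n ω) (q n ω) ^ p ∂P ≤ C := by
  obtain ⟨M, hM0, hM⟩ := SAV.exists_integral_momentWeight_le ⌈p⌉₊ T
  obtain ⟨C, j, hC0, hC⟩ := hfg.exists_initial_energy_le
  set r := ⌈p⌉₊ with hr
  set I₀ := ∫ ω, (C * (1 + S.normProd (u₀ ω) (v₀ ω)) ^ j) ^ (r + 1) ∂P with hI₀
  have hρ : ∀ ω, 0 ≤ S.normProd (u₀ ω) (v₀ ω) := fun ω => Real.sqrt_nonneg _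
  have hI₀_nonneg : 0 ≤ I₀ := integral_nonneg fun ω => by have := hρ ω; positivity
  have hint : Integrable (fun ω => (C * (1 + S.normProd (u₀ ω) (v₀ ω)) ^ j) ^ (r + 1)) P := by
    simp only [mul_pow, ← pow_mul]
    exact (SAV.integrable_one_add_pow hρ hmom _).const_mul _
  set A := SAV.stepConst r (4 * c₂ ^ 2) * M * (4 * c₂ ^ 2) with hA
  have hA0 : 0 ≤ A := by
    have := SAV.stepConst_nonneg r (K := 4 * c₂ ^ 2) (by positivity)
    positivity
  -- Chosen before `β`, the scheme and `N`: `A` depends on `T`, `p` and `c₂`, while `I₀` depends on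
  -- `X₀`, `p` and the coefficients. The `+ 1` only secures positivity.
  refine ⟨Real.exp (A * T) * I₀ + 1, by positivity, ?_⟩
  intro β hβ scheme π N hN u v q h n hn
  have hN0 : (0 : ℝ≥0) < N := Nat.cast_pos.2 hN
  have hτ : 0 < T / N := div_pos hT hN0
  have hτT : T / N ≤ T := div_le_self zero_le (Nat.one_le_cast.2 hN)
  obtain ⟨hi₀, hle₀⟩ := h.initial_moment_le hC hX₀ r hint
  obtain ⟨h1, h2⟩ := h.moment_le hfg hg hβ hτ hM0 (hM _ hτT) hi₀ hle₀ n hn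
  have hnT : (n : ℝ) * ((T / N : ℝ≥0) : ℝ) ≤ T := by
    have : (n : ℝ≥0) * (T / N) ≤ T := by
      calc (n : ℝ≥0) * (T / N) ≤ N * (T / N) := by gcongr
        _ = T := mul_div_cancel₀ _ hN0.ne'
    exact_mod_cast this
  have hV := fun ω => SAV.energy_nonneg S (u n ω) (v n ω) (q n ω)
  have hp0 : 0 ≤ p := zero_le_one.trans hp
  have hi : Integrable (fun ω => SAV.energy S (u n ω) (v n ω) (q n ω) ^ p) P := by
    refine h1.mono' ((h.measurable_energy hn).pow_const p).aestronglyMeasurable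
      (ae_of_all _ fun ω => ?_)
    rw [Real.norm_of_nonneg (Real.rpow_nonneg (hV ω) p)]
    exact SAV.rpow_le_one_add_pow_ceil (hV ω) hp0
  refine ⟨hi, ?_⟩
  calc ∫ ω, SAV.energy S (u n ω) (v n ω) (q n ω) ^ p ∂P
      ≤ ∫ ω, (1 + SAV.energy S (u n ω) (v n ω) (q n ω)) ^ (r + 1) ∂P :=
        integral_mono hi h1 fun ω => SAV.rpow_le_one_add_pow_ceil (hV ω) hp0
    _ ≤ Real.exp (A * (n * ((T / N : ℝ≥0) : ℝ))) * I₀ := h2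
    _ ≤ Real.exp (A * T) * I₀ := by gcongr
    _ ≤ _ := by linarith
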